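/- Let $n\ge 2$ and consider the root system of type $D_{n+1}$ in $\mathbb Z^{n+1}=\bigoplus_a\mathbb Z\varepsilon_a$, with $\Phi^+=\{\varepsilon_a\pm\varepsilon_b: 1\le a<b\le n+1\}$, simple roots $\alpha_i=\varepsilon_i-\varepsilon_{i+1}$ $(1\le i\le n)$, $\alpha_{n+1}=\varepsilon_n+\varepsilon_{n+1}$, simple reflections $s_i$ and longest Weyl group element $w_0$. Let $\vee$ be the involution of $\{1,\dots,n+1\}$ swapping $n$ and $n+1$ and fixing the other indices; the orbit $\bar i$ of $i$ is identified with the integer $\min(i,n)\in\{1,\dots,n\}$. **Twisted quivers.** A twisted Dynkin quiver $Q^{\leftarrow}$ is an orientation of the path $1-2-\cdots-n$ of orbits together with a choice $h\in\{n,n+1\}$ (the head). An index $i$ is a sink (source) of $Q^{\leftarrow}$ if no arrow exits from (enters) $\bar i$ and, when $\bar i=n$, moreover $i=h$. If $i$ is a sink or source, $iQ^{\leftarrow}$ is obtained by reversing all arrows at $\bar i$ and, when $\bar i=n$, replacing $h$ by $h^\vee$; otherwise $iQ^{\leftarrow}=Q^{\leftarrow}$. A word $i_1i_2\cdots i_l$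 is adapted to $Q^{\leftarrow}$ if $i_k$ is a sink of $i_{k-1}\cdots i_1Q^{\leftarrow}$ for all $k$. Let $[Q^{\leftarrow}]$ be the set of all reduced words of $w_0$ adapted to $Q^{\leftarrow}$. A word $\mathbf i=i_1\cdots i_N\in[Q^{\leftarrow}]$ orders $\Phi^+$ by $\beta_1<_{\mathbf i}\beta_2<_{\mathbf i}\cdots$, where $\beta_k=s_{i_1}\cdots s_{i_{k-1}}(\alpha_{i_k})$; write $\alpha\prec\beta$ if $\alpha<_{\mathbf i}\beta$ for all $\mathbf i\in[Q^{\leftarrow}]$. **Minimal pairs.** A sequence is a family $\underline m=(m_\beta)_{\beta\in\Phi^+}$ of non-negative integers; its weight is $\sum_\beta m_\beta\beta$. Write $\underline m\prec^{\mathsf b}\underline m'$ if the weights agree and, for every $\mathbf i\in[Q^{\leftarrow}]$, the entry of $\underline m$ is smaller than that of $\underline m'$ both at the first and at the last root (for $<_{\mathbf i}$) at which the two sequences differ. A pair $(\alpha,\beta)$ of positive roots is a $[Q^{\leftarrow}]$-minimal pair of $\gamma\in\Phi^+$ if $\alpha\prec\beta$, $\gamma\prec^{\mathsf b}(\alpha,\beta)$,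 and there is no sequence $\underline m'$ with $\gamma\prec^{\mathsf b}\underline m'\prec^{\mathsf b}(\alpha,\beta)$; here $\gamma$ and $(\alpha,\beta)$ stand for the sequences with entry $1$ at the listed roots and $0$ elsewhere. **Folded coordinates.** Let $i_1\cdots i_n$ be a word adapted to $Q^{\leftarrow}$ with exactly one letter from each $\vee$-orbit, let $\xi:\{1,\dots,n\}\to\mathbb Z$ satisfy $\xi(b)=\xi(a)+1$ for each arrow $a\to b$ of $Q^{\leftarrow}$, and let $\psi=s_{i_1}\cdots s_{i_n}s_{i_1^\vee}\cdots s_{i_n^\vee}$. Positive roots are given folded coordinates $\widehat\phi\in\{1,\dots,n\}\times\mathbb Z$ by the rules: $s_{i_1}\cdots s_{i_{k-1}}(\alpha_{i_k})$ has coordinate $(\bar i_k,\xi(\bar i_k))$; $s_{i_1}\cdots s_{i_n}s_{i_1^\vee}\cdots s_{i_{k-1}^\vee}(\alpha_{i_k^\vee})$ has coordinate $(\bar i_k,\xi(\bar i_k)-2)$; and if $\beta,\psi(\beta)\in\Phi^+$ and $\beta$ has coordinate $(\bar i,p)$, then $\psi(\beta)$ has coordinate $(\bar i,p-4)$. **Corollary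 8.25.** Let $\alpha,\beta,\gamma\in\Phi^+$ with $\alpha+\beta=\gamma$ have folded coordinates $(\bar i,p)$, $(\bar j,q)$, $(\bar k,r)$ respectively. Then $(\alpha,\beta)$ is a $[Q^{\leftarrow}]$-minimal pair of $\gamma$ if and only if $\ell:=\max(\bar i,\bar j,\bar k)\le n$, the other two members of the multiset $\{\bar i,\bar j,\bar k\}$ (one copy of $\ell$ removed) have sum $\ell$, and $$(q-r,\;p-r)=\begin{cases}(-\bar i,\;\bar j)&\text{if }\ell=\bar k,\\(\bar i-(2n+2),\;\bar j)&\text{if }\ell=\bar i,\\(-\bar i,\;2n+2-\bar j)&\text{if }\ell=\bar j.\end{cases}$$ -/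

import Mathlib

namespace TwistedD

/-! ### The root system of type `D_{n+1}`

The Dynkin vertices `1, …, n+1` are represented by `Fin (n + 1)`: the element with value `i` is the
vertex `i + 1`. -/

/-- The ambient lattice `ℤ^{n+1}` with standard basis `ε_1, …, ε_{n+1}`. -/
abbrev Lat (n : ℕ) : Type := Fin (n + 1) → ℤ

/-- The simple roots: `α_i = ε_i - ε_{i+1}` for `1 ≤ i ≤ n`, and `α_{n+1} = ε_n + ε_{n+1}`. -/
def simpleRoot (n : ℕ) (i : Fin (n + 1)) : Lat n := fun k =>
  if i.val < n then
    (if k.val = i.val then 1 else if k.val = i.val + 1 then -1 else 0)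
  else
    (if k.val = n ∨ k.val + 1 = n then 1 else 0)

/-- The positive roots `ε_a ± ε_b`, `a < b`, of type `D_{n+1}`. -/
def IsPosRoot (n : ℕ) (v : Lat n) : Prop :=
  ∃ a b : Fin (n + 1), a < b ∧
    (v = Pi.single a 1 - Pi.single b 1 ∨ v = Pi.single a 1 + Pi.single b 1)

/-- The set `Φ⁺` of positive roots. -/
abbrev PosRoot (n : ℕ) : Type := {v : Lat n // IsPosRoot n v}

/-- The simple reflection `s_i(v) = v - (v, α_i) α_i` (all roots have square length `2`). -/
def simpleReflection (n : ℕ) (i : Fin (n + 1)) : Module.End ℤ (Lat n) where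
  toFun v := v - (v ⬝ᵥ simpleRoot n i) • simpleRoot n i
  map_add' v w := by
    rw [add_dotProduct, add_smul]; abel
  map_smul' c v := by
    simp only [smul_dotProduct, smul_eq_mul, RingHom.id_apply, smul_sub, mul_smul]

/-- The element `s_{i_1} s_{i_2} ⋯ s_{i_l}` of the Weyl group attached to a word `i_1 i_2 ⋯ i_l`. -/
def wordProd (n : ℕ) (w : List (Fin (n + 1))) : Module.End ℤ (Lat n) :=
  (w.map (simpleReflection n)).prod

/-- The word is a reduced word of the Weyl group element that it represents. -/
def IsReduced (n : ℕ) (w : List (Fin (n + 1))) : Prop :=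
  ∀ w' : List (Fin (n + 1)), wordProd n w' = wordProd n w → w.length ≤ w'.length

/-- The word is a reduced word of the longest element `w₀`, that is, of the element of the Weyl
group which sends every positive root to a negative root. -/
def IsReducedLongest (n : ℕ) (w : List (Fin (n + 1))) : Prop :=
  IsReduced n w ∧ ∀ β : Lat n, IsPosRoot n β → IsPosRoot n (-(wordProd n w β))

/-- `β_k = s_{i_1} ⋯ s_{i_{k-1}} (α_{i_k})` for a word `i_1 i_2 ⋯ i_l`. -/
def rootAt (n : ℕ) (w : List (Fin (n + 1))) (k : Fin w.length) : Lat n :=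
  wordProd n (w.take k.val) (simpleRoot n (w.get k))

/-- The order `<_w` attached to a word `w`: `β_k <_w β_l` if and only if `k < l`. -/
def Before (n : ℕ) (w : List (Fin (n + 1))) (α β : Lat n) : Prop :=
  ∃ k l : Fin w.length, k < l ∧ rootAt n w k = α ∧ rootAt n w l = β

/-! ### The diagram automorphism and twisted Dynkin quivers -/

/-- The automorphism `∨` of the Dynkin diagram: it swaps `n` and `n+1` and fixes the others. -/
def vee (n : ℕ) (i : Fin (n + 1)) : Fin (n + 1) :=
  if i.val = n then ⟨n - 1, by omega⟩ else if i.val + 1 = n then Fin.last n else i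

/-- The orbit of a vertex under `∨`, as a number in `{1, …, n}`: vertex `i ≤ n` has orbit `i`,
vertex `n+1` has orbit `n`. -/
def fold (n : ℕ) (i : Fin (n + 1)) : ℕ := min (i.val + 1) n

/-- A twisted Dynkin quiver of type `D_{n+1}`: an orientation of each edge of the path
`1 — 2 — ⋯ — n` of `∨`-orbits, together with the choice `head` of one of the two vertices
`n`, `n+1` in the last orbit. -/
structure TwistedQuiver (n : ℕ) where
  /-- `arrow a b` says that there is an arrow `a → b`. -/
  arrow : ℕ → ℕ → Prop
  head : Fin (n + 1)
  edge_of_arrow : ∀ a b, arrow a b → 1 ≤ a ∧ a ≤ n ∧ 1 ≤ b ∧ b ≤ n ∧ (b = a + 1 ∨ a = b + 1)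
  oriented : ∀ a, 1 ≤ a → a + 1 ≤ n → Xor (arrow a (a + 1)) (arrow (a + 1) a)
  fold_head : fold n head = n

namespace TwistedQuiver

variable {n : ℕ}

/-- A vertex `i` is a sink if no arrow exits from its orbit; in the last orbit, only `head` can
be a sink. -/
def IsSink (Q : TwistedQuiver n) (i : Fin (n + 1)) : Prop :=
  (fold n i = n → i = Q.head) ∧ ∀ b, ¬ Q.arrow (fold n i) b

/-- A vertex `i` is a source if no arrow enters its orbit; in the last orbit, only `head` can
be a source. -/
def IsSource (Q : TwistedQuiver n) (i : Fin (n + 1)) : Prop :=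
  (fold n i = n → i = Q.head) ∧ ∀ a, ¬ Q.arrow a (fold n i)

theorem fold_vee {i : Fin (n + 1)} (h : fold n i = n) : fold n (vee n i) = n := by
  unfold vee fold at *
  split_ifs <;> simp <;> omega

/-- Reverse all arrows at the orbit of `i`, and exchange the two vertices of the last orbit if `i`
is the head. -/
def flip (Q : TwistedQuiver n) (i : Fin (n + 1)) : TwistedQuiver n where
  arrow a b := if a = fold n i ∨ b = fold n i then Q.arrow b a else Q.arrow a b
  head := if i = Q.head then vee n Q.head else Q.head
  edge_of_arrow a b h := by
    split_ifs at h
    · have := Q.edge_of_arrow _ _ h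
      omega
    · exact Q.edge_of_arrow _ _ h
  oriented a h1 h2 := by
    have := Q.oriented a h1 h2
    by_cases h : a = fold n i ∨ a + 1 = fold n i
    · rw [if_pos h, if_pos h.symm]
      exact this.symm
    · rw [if_neg h, if_neg (fun h' => h h'.symm)]
      exact this
  fold_head := by
    split_ifs
    · exact fold_vee Q.fold_head
    · exact Q.fold_head

open Classical in
/-- The quiver `i Q`: it is `Q.flip i` if `i` is a sink or a source of `Q`, and `Q` otherwise. -/
noncomputable def reflect (Q : TwistedQuiver n) (i : Fin (n + 1)) : TwistedQuiver n :=
  if Q.IsSink i ∨ Q.IsSource i then Q.flip i else Q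

/-- The word `i_1 i_2 ⋯ i_l` is adapted to `Q`: each `i_k` is a sink of `i_{k-1} ⋯ i_1 Q`. -/
def Adapted : TwistedQuiver n → List (Fin (n + 1)) → Prop
  | _, [] => True
  | Q, i :: w => Q.IsSink i ∧ Adapted (Q.reflect i) w

/-- The class `[Q]` of all reduced words of `w₀` that are adapted to `Q`. -/
def cls (Q : TwistedQuiver n) : Set (List (Fin (n + 1))) :=
  {w | IsReducedLongest n w ∧ Q.Adapted w}

/-- The partial order `≺_{[Q]}` on roots: `α <_w β` for all words `w` of the class `[Q]`. -/
def Prec (Q : TwistedQuiver n) (α β : Lat n) : Prop :=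
  ∀ w ∈ Q.cls, Before n w α β

end TwistedQuiver

/-! ### Sequences of positive roots and minimal pairs

A sequence `(m_1, …, m_N)` of non-negative integers, indexed by the positive roots in the order
given by a word, is recorded as the family of multiplicities `m_β`, `β ∈ Φ⁺`. -/

/-- The weight `∑ m_β β` of a sequence. -/
def weight {n : ℕ} (m : PosRoot n →₀ ℕ) : Lat n := m.sum fun β c => c • β.val

/-- The bi-lexicographical order attached to a word: at the first position where the two
sequences differ, and also at the last such position, the entry of `m` is the smaller one. -/
def BiLex (n : ℕ) (w : List (Fin (n + 1))) (m m' : PosRoot n →₀ ℕ) : Prop :=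
  (∃ β : PosRoot n, m β < m' β ∧ ∀ δ : PosRoot n, Before n w δ.val β.val → m δ = m' δ) ∧
  (∃ β : PosRoot n, m β < m' β ∧ ∀ δ : PosRoot n, Before n w β.val δ.val → m δ = m' δ)

namespace TwistedQuiver

variable {n : ℕ}

/-- The order `≺ᵇ_{[Q]}` on sequences: equal weights, and smaller for the bi-lexicographical order
of every word of the class `[Q]`. -/
def SeqPrec (Q : TwistedQuiver n) (m m' : PosRoot n →₀ ℕ) : Prop :=
  weight m = weight m' ∧ ∀ w ∈ Q.cls, BiLex n w m m'

/-- `m` is a `[Q]`-minimal sequence of `s`: `m` covers `s` for `≺ᵇ_{[Q]}`. -/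
def IsMinimalSeq (Q : TwistedQuiver n) (s m : PosRoot n →₀ ℕ) : Prop :=
  Q.SeqPrec s m ∧ ¬ ∃ m' : PosRoot n →₀ ℕ, Q.SeqPrec s m' ∧ Q.SeqPrec m' m

/-- `(α, β)` is a `[Q]`-minimal pair of the positive root `γ`: the pair is written in increasing
order, and it is a `[Q]`-minimal sequence of the one-term sequence `γ` (which is simple). -/
def IsMinimalPair (Q : TwistedQuiver n) (α β γ : PosRoot n) : Prop :=
  Q.Prec α.val β.val ∧
    Q.IsMinimalSeq (Finsupp.single γ 1) (Finsupp.single α 1 + Finsupp.single β 1)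

/-! ### Coordinates -/

/-- `c = i_1 ⋯ i_n` is a word of the twisted Coxeter element `(s_{i_1} ⋯ s_{i_n}) ∨` of `Q`: it
has exactly one letter from each orbit of `∨`, and it is adapted to `Q`. -/
def IsCoxeterWord (Q : TwistedQuiver n) (c : List (Fin (n + 1))) : Prop :=
  (c.map (fold n)).Perm (List.range' 1 n) ∧ Q.Adapted c

/-- Height functions: `ξ(b) = ξ(a) + 1` whenever there is an arrow `a → b`. -/
def IsHeight (Q : TwistedQuiver n) (ξ : ℕ → ℤ) : Prop :=
  ∀ a b, Q.arrow a b → ξ b = ξ a + 1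

end TwistedQuiver

/-- `TwistedCoord c ξ β i p` says that the algorithm labelling the twisted Auslander–Reiten quiver,
run with the word `c = i_1 ⋯ i_n` and the height function `ξ`, gives the positive root `β` the
coordinate `(i, p)`.  Here `ψ = s_{i_1} ⋯ s_{i_n} s_{i_1^∨} ⋯ s_{i_n^∨}`. -/
inductive TwistedCoord {n : ℕ} (c : List (Fin (n + 1))) (ξ : ℕ → ℤ) :
    Lat n → Fin (n + 1) → ℤ → Prop
  | first (k : Fin c.length) :
      TwistedCoord c ξ (rootAt n c k) (c.get k) (ξ (fold n (c.get k)))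
  | second (k : Fin c.length) :
      TwistedCoord c ξ
        (wordProd n (c ++ (c.take k.val).map (vee n)) (simpleRoot n (vee n (c.get k))))
        (vee n (c.get k)) (ξ (fold n (c.get k)) - 2)
  | step (β : Lat n) (i : Fin (n + 1)) (p : ℤ) (hβ : IsPosRoot n β)
      (hψ : IsPosRoot n (wordProd n (c ++ c.map (vee n)) β)) (h : TwistedCoord c ξ β i p) :
      TwistedCoord c ξ (wordProd n (c ++ c.map (vee n)) β) i (p - 4)

/-- `β` has folded coordinate `(a, p)`, where `a ∈ {1, …, n}` is the orbit of its residue. -/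
def FoldedCoord {n : ℕ} (c : List (Fin (n + 1))) (ξ : ℕ → ℤ) (β : PosRoot n) (a : ℕ) (p : ℤ) :
    Prop :=
  ∃ i : Fin (n + 1), TwistedCoord c ξ β.val i p ∧ fold n i = a

end TwistedD

/-! The proof turns roots into intervals on a line. Put `L = 2n+2`. There is a function `x : ℤ →
ℤ^{n+1}` with `x (z + L) = -x z` which, on one parity class, runs through the vectors `±ε_v` over
each antiperiod (`frame`). The root with folded coordinate `(a, p)` is `rt x a p = x (p + a) - x (p
- a)`, that is, the interval `[p - a, p + a]`. The reason is that popping a sink of orbit `a` lowers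
the height function by `2` at `a` and exchanges the two neighbouring positions `h a + a` and `h a -
a`; in the last orbit the exchange wraps around the antiperiod, and the sign is absorbed by the
change of head (`IsFrame.step`). The adapted reduced words of `w₀` are the adapted words lowering
every height by exactly `L` (`full_iff`).

It follows that `α ≺ β` means that both endpoints of `α` are at least those of `β`, with `α ≠ β`
(`prec_iff`). A sequence of weight `α + β` is below the pair `(α, β)` exactly when its support lies
strictly between `α` and `β` (`seqPrec_pair`, `SeqPrec.prec_and_prec`).

If `α + β = γ`, the inner product of `α` and `β` is `-1`, so the two intervals share an endpoint
directly or modulo the antiperiod. This leaves three configurations. In the two with wrap-around,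
and in the adjacent one with `i + j ≤ n`, the coordinate of `γ` can be read off and gives the three
lines of the formula. An adjacent pair with `i + j = n + 1` would make `γ` twice a basis vector up
to sign; with `i + j > n + 1`, splitting the interval of `γ` at the common endpoint gives a pair
strictly in between (`IsMinimalPair.lab_eq`).

Conversely, every antiperiodic function is a linear functional on the frame (`exists_functional`).
Testing a sequence of weight `γ` against indicator functions shows that, if it lies between `α` and
`β`, one of its intervals is that of `γ`. It is therefore `γ` itself (`isMinimalPair_of_lab`). -/

namespace TwistedD

variable {n : ℕ}

/-! ### Simple reflections and positive roots of type `D_{n+1}`. -/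

/-- The standard basis vector `ε_a`. -/
abbrev eps (a : Fin (n + 1)) : Lat n := Pi.single a 1

theorem simpleRoot_of_lt (i : Fin (n + 1)) (h : i.val < n) :
    simpleRoot n i = eps i - eps ⟨i.val + 1, by omega⟩ := by
  ext k
  simp only [simpleRoot, h, if_true, eps, Pi.sub_apply, Pi.single_apply, Fin.ext_iff]
  split_ifs <;> omega

theorem simpleRoot_of_eq (hn : 1 ≤ n) (i : Fin (n + 1)) (h : i.val = n) :
    simpleRoot n i = eps ⟨n - 1, by omega⟩ + eps i := by
  ext k
  have : ¬ i.val < n := by omega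
  simp only [simpleRoot, this, if_false, eps, Pi.add_apply, Pi.single_apply, Fin.ext_iff]
  split_ifs <;> omega

theorem simpleReflection_apply (i : Fin (n + 1)) (v : Lat n) :
    simpleReflection n i v = v - (v ⬝ᵥ simpleRoot n i) • simpleRoot n i := rfl

theorem simpleReflection_eps (i a : Fin (n + 1)) :
    simpleReflection n i (eps a) = eps a - (simpleRoot n i a) • simpleRoot n i := by
  rw [simpleReflection_apply, single_one_dotProduct]

theorem simpleReflection_eps_self (i : Fin (n + 1)) (h : i.val < n) :
    simpleReflection n i (eps i) = eps ⟨i.val + 1, by omega⟩ := by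
  rw [simpleReflection_eps, simpleRoot_of_lt i h]
  simp [Fin.ext_iff]

theorem simpleReflection_eps_succ (i : Fin (n + 1)) (h : i.val < n) :
    simpleReflection n i (eps ⟨i.val + 1, by omega⟩) = eps i := by
  rw [simpleReflection_eps, simpleRoot_of_lt i h]
  simp [Fin.ext_iff]

theorem simpleReflection_eps_of_ne (i a : Fin (n + 1)) (h : i.val < n) (h1 : a.val ≠ i.val)
    (h2 : a.val ≠ i.val + 1) : simpleReflection n i (eps a) = eps a := by
  rw [simpleReflection_eps, simpleRoot_of_lt i h]
  simp [Fin.ext_iff, h1, h2]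

theorem simpleReflection_last_eps_pred (i m : Fin (n + 1)) (h : i.val = n) (hm : m.val + 1 = n) :
    simpleReflection n i (eps m) = - eps i := by
  have e : m = ⟨n - 1, by omega⟩ := Fin.ext (by simp; omega)
  rw [simpleReflection_eps, simpleRoot_of_eq (by omega) i h, ← e]
  have : m.val ≠ i.val := by omega
  simp [Fin.ext_iff, this]

theorem simpleReflection_last_eps_last (i m : Fin (n + 1)) (h : i.val = n) (hm : m.val + 1 = n) :
    simpleReflection n i (eps i) = - eps m := by
  have e : m = ⟨n - 1, by omega⟩ := Fin.ext (by simp; omega)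
  rw [simpleReflection_eps, simpleRoot_of_eq (by omega) i h, ← e]
  have : i.val ≠ m.val := by omega
  simp [Fin.ext_iff, this]

theorem simpleReflection_last_eps_of_lt (hn : 1 ≤ n) (i a : Fin (n + 1)) (h : i.val = n)
    (ha : a.val + 1 < n) : simpleReflection n i (eps a) = eps a := by
  rw [simpleReflection_eps, simpleRoot_of_eq hn i h]
  have h1 : a.val ≠ i.val := by omega
  have h2 : a.val ≠ n - 1 := by omega
  simp [Fin.ext_iff, h1, h2]

theorem isPosRoot_simpleRoot (hn : 1 ≤ n) (i : Fin (n + 1)) : IsPosRoot n (simpleRoot n i) := by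
  by_cases h : i.val < n
  · exact ⟨i, ⟨i.val + 1, by omega⟩, by simp [Fin.lt_def], Or.inl (simpleRoot_of_lt i h)⟩
  · exact ⟨⟨n - 1, by omega⟩, i, by simp [Fin.lt_def]; omega,
      Or.inr (simpleRoot_of_eq hn i (by omega))⟩

theorem IsPosRoot.dotProduct_self {v : Lat n} (h : IsPosRoot n v) : v ⬝ᵥ v = 2 := by
  obtain ⟨a, b, hab, rfl | rfl⟩ := h
  · simp [dotProduct_sub, hab.ne, hab.ne']
  · simp [dotProduct_add, hab.ne, hab.ne']

/-- Pairing with the dominant weight `(n, …, 1, 0)`. -/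
def rhoPairing (n : ℕ) : Lat n →ₗ[ℤ] ℤ where
  toFun v := ∑ a, v a * (n - a.val)
  map_add' v w := by simp [add_mul, Finset.sum_add_distrib]
  map_smul' c v := by simp [Finset.mul_sum, mul_assoc]

theorem rhoPairing_eps (a : Fin (n + 1)) : rhoPairing n (eps a) = n - a.val := by
  simp [rhoPairing, Pi.single_apply]

theorem IsPosRoot.rhoPairing_pos {v : Lat n} (h : IsPosRoot n v) : 0 < rhoPairing n v := by
  obtain ⟨a, b, hab, rfl | rfl⟩ := h
  · rw [map_sub, rhoPairing_eps, rhoPairing_eps]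
    have := Fin.lt_def.1 hab
    omega
  · rw [map_add, rhoPairing_eps, rhoPairing_eps]
    have := Fin.lt_def.1 hab
    omega

theorem IsPosRoot.not_neg {v : Lat n} (h : IsPosRoot n v) : ¬ IsPosRoot n (-v) := fun h' => by
  have h1 := h.rhoPairing_pos
  have h2 := h'.rhoPairing_pos
  rw [map_neg] at h2
  omega

theorem isPosRoot_sub {a b : Fin (n + 1)} (h : a < b) : IsPosRoot n (eps a - eps b) :=
  ⟨a, b, h, Or.inl rfl⟩

theorem isPosRoot_add {a b : Fin (n + 1)} (h : a ≠ b) : IsPosRoot n (eps a + eps b) := by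
  rcases lt_or_gt_of_ne h with h | h
  · exact ⟨a, b, h, Or.inr rfl⟩
  · exact ⟨b, a, h, Or.inr (add_comm _ _)⟩

theorem simpleReflection_eps_swap (i a : Fin (n + 1)) (h : i.val < n) :
    simpleReflection n i (eps a) = eps (Equiv.swap i ⟨i.val + 1, by omega⟩ a) := by
  by_cases h1 : a = i
  · subst h1; rw [simpleReflection_eps_self a h, Equiv.swap_apply_left]
  by_cases h2 : a = ⟨i.val + 1, by omega⟩
  · subst h2; rw [simpleReflection_eps_succ i h, Equiv.swap_apply_right]
  · rw [simpleReflection_eps_of_ne i a h (fun e => h1 (Fin.ext e)) (fun e => h2 (Fin.ext e)),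
      Equiv.swap_apply_of_ne_of_ne h1 h2]

/-- A simple reflection `s_i` permutes the positive roots other than `α_i`. -/
theorem IsPosRoot.simpleReflection (hn : 1 ≤ n) {v : Lat n} (h : IsPosRoot n v)
    (i : Fin (n + 1)) : v = simpleRoot n i ∨ IsPosRoot n (TwistedD.simpleReflection n i v) := by
  obtain ⟨a, b, hab, hv⟩ := h
  have hab' := Fin.lt_def.1 hab
  by_cases hi : i.val < n
  · have hne : Equiv.swap i ⟨i.val + 1, by omega⟩ a ≠ Equiv.swap i ⟨i.val + 1, by omega⟩ b :=
      fun e => hab.ne ((Equiv.swap i _).injective e)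
    rcases hv with rfl | rfl
    · by_cases hs : a = i ∧ b = ⟨i.val + 1, by omega⟩
      · left
        rw [simpleRoot_of_lt i hi, hs.1, hs.2]
      · right
        rw [map_sub, simpleReflection_eps_swap i a hi, simpleReflection_eps_swap i b hi]
        refine isPosRoot_sub ?_
        simp only [Equiv.swap_apply_def, Fin.lt_def, Fin.ext_iff] at hs ⊢
        split_ifs <;> simp <;> omega
    · right
      rw [map_add, simpleReflection_eps_swap i a hi, simpleReflection_eps_swap i b hi]
      exact isPosRoot_add hne
  · have hi : i.val = n := by omega
    obtain ⟨m, hm⟩ : ∃ m : Fin (n + 1), m.val + 1 = n := ⟨⟨n - 1, by omega⟩, by simp; omega⟩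
    have hp := simpleReflection_last_eps_pred i m hi hm
    have hl := simpleReflection_last_eps_last i m hi hm
    by_cases hb : b = i
    · subst hb
      by_cases ha : a = m
      · subst ha
        rcases hv with rfl | rfl
        · right
          rw [map_sub, hp, hl, neg_sub_neg]
          exact isPosRoot_sub hab
        · left
          rw [simpleRoot_of_eq hn b hi]
          congr 2
          exact Fin.ext (by simp; omega)
      · right
        have ha' : a.val + 1 < n := by
          have : a.val ≠ m.val := fun e => ha (Fin.ext e)
          omega
        have hlt : a < m := by rw [Fin.lt_def]; omega
        rcases hv with rfl | rfl
        · rw [map_sub, simpleReflection_last_eps_of_lt hn b a hi ha', hl, sub_neg_eq_add]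
          exact isPosRoot_add hlt.ne
        · rw [map_add, simpleReflection_last_eps_of_lt hn b a hi ha', hl, ← sub_eq_add_neg]
          exact isPosRoot_sub hlt
    · right
      have hbn : b.val ≠ i.val := fun e => hb (Fin.ext e)
      have ha' : a.val + 1 < n := by omega
      by_cases hb' : b = m
      · subst hb'
        have hlt : a < i := by rw [Fin.lt_def]; omega
        rcases hv with rfl | rfl
        · rw [map_sub, simpleReflection_last_eps_of_lt hn i a hi ha', hp, sub_neg_eq_add]
          exact isPosRoot_add hlt.ne
        · rw [map_add, simpleReflection_last_eps_of_lt hn i a hi ha', hp, ← sub_eq_add_neg]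
          exact isPosRoot_sub hlt
      · have hb2 : b.val + 1 < n := by
          have : b.val ≠ m.val := fun e => hb' (Fin.ext e)
          omega
        rcases hv with rfl | rfl
        · rw [map_sub, simpleReflection_last_eps_of_lt hn i a hi ha',
            simpleReflection_last_eps_of_lt hn i b hi hb2]
          exact isPosRoot_sub hab
        · rw [map_add, simpleReflection_last_eps_of_lt hn i a hi ha',
            simpleReflection_last_eps_of_lt hn i b hi hb2]
          exact isPosRoot_add hab.ne

theorem simpleReflection_simpleRoot (hn : 1 ≤ n) (i : Fin (n + 1)) :
    simpleReflection n i (simpleRoot n i) = - simpleRoot n i := by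
  rw [simpleReflection_apply, (isPosRoot_simpleRoot hn i).dotProduct_self, two_smul]
  abel

theorem simpleReflection_simpleReflection (hn : 1 ≤ n) (i : Fin (n + 1)) (v : Lat n) :
    simpleReflection n i (simpleReflection n i v) = v := by
  conv_lhs => rw [simpleReflection_apply i v, map_sub, map_smul, simpleReflection_simpleRoot hn,
    simpleReflection_apply]
  simp

theorem simpleReflection_dotProduct (hn : 1 ≤ n) (i : Fin (n + 1)) (v w : Lat n) :
    simpleReflection n i v ⬝ᵥ simpleReflection n i w = v ⬝ᵥ w := by
  rw [simpleReflection_apply, simpleReflection_apply]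
  simp only [sub_dotProduct, dotProduct_sub, smul_dotProduct, dotProduct_smul,
    (isPosRoot_simpleRoot hn i).dotProduct_self, smul_eq_mul, dotProduct_comm (simpleRoot n i) w]
  ring

/-! ### Words -/

@[simp] theorem wordProd_nil : wordProd n [] = 1 := rfl

@[simp] theorem wordProd_cons (i : Fin (n + 1)) (w : List (Fin (n + 1))) :
    wordProd n (i :: w) = simpleReflection n i * wordProd n w := by
  simp [wordProd]

theorem wordProd_append (u v : List (Fin (n + 1))) :
    wordProd n (u ++ v) = wordProd n u * wordProd n v := by
  simp [wordProd]

theorem wordProd_dotProduct (hn : 1 ≤ n) (u : List (Fin (n + 1))) (v w : Lat n) :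
    wordProd n u v ⬝ᵥ wordProd n u w = v ⬝ᵥ w := by
  induction u with
  | nil => rfl
  | cons i u ih =>
    simp only [wordProd_cons, Module.End.mul_apply]
    rw [simpleReflection_dotProduct hn, ih]

theorem wordProd_mul_simpleReflection (hn : 1 ≤ n) {u : List (Fin (n + 1))} {i j : Fin (n + 1)}
    (h : wordProd n u (simpleRoot n i) = simpleRoot n j) :
    wordProd n u * simpleReflection n i = simpleReflection n j * wordProd n u := by
  refine LinearMap.ext fun v => ?_
  simp only [Module.End.mul_apply]
  rw [simpleReflection_apply, simpleReflection_apply, map_sub, map_smul, h, ← h,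
    wordProd_dotProduct hn]

theorem isPosRoot_or_neg_simpleReflection (hn : 1 ≤ n) {v : Lat n}
    (h : IsPosRoot n v ∨ IsPosRoot n (-v)) (i : Fin (n + 1)) :
    IsPosRoot n (simpleReflection n i v) ∨ IsPosRoot n (-simpleReflection n i v) := by
  rcases h with h | h
  · rcases h.simpleReflection hn i with rfl | h'
    · right; rw [simpleReflection_simpleRoot hn, neg_neg]; exact isPosRoot_simpleRoot hn i
    · exact Or.inl h'
  · rcases h.simpleReflection hn i with h' | h'
    · left
      rw [← neg_neg v, map_neg, h', simpleReflection_simpleRoot hn, neg_neg]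
      exact isPosRoot_simpleRoot hn i
    · right; rwa [← map_neg]

theorem isPosRoot_or_neg_wordProd (hn : 1 ≤ n) {v : Lat n}
    (h : IsPosRoot n v ∨ IsPosRoot n (-v)) (u : List (Fin (n + 1))) :
    IsPosRoot n (wordProd n u v) ∨ IsPosRoot n (-wordProd n u v) := by
  induction u with
  | nil => exact h
  | cons i u ih =>
    simp only [wordProd_cons, Module.End.mul_apply]
    exact isPosRoot_or_neg_simpleReflection hn ih i

/-- If a word makes a positive root non-positive, it does so at a definite letter. -/
theorem exists_split_of_not_isPosRoot (hn : 1 ≤ n) {v : Lat n} (hv : IsPosRoot n v)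
    (u : List (Fin (n + 1))) (h : ¬ IsPosRoot n (wordProd n u v)) :
    ∃ u₁ j u₂, u = u₁ ++ j :: u₂ ∧ wordProd n u₂ v = simpleRoot n j := by
  induction u with
  | nil => exact absurd hv h
  | cons i u ih =>
    by_cases hu : IsPosRoot n (wordProd n u v)
    · rcases hu.simpleReflection hn i with h' | h'
      · exact ⟨[], i, u, rfl, h'⟩
      · exact absurd (by simpa using h') h
    · obtain ⟨u₁, j, u₂, rfl, hj⟩ := ih hu
      exact ⟨i :: u₁, j, u₂, rfl, hj⟩

/-- Deletion argument: if the `k`-th root is not positive, some earlier letter is the one that makes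
it negative. Removing that letter and the `k`-th one leaves the product unchanged and contradicts
reducedness. -/
theorem IsReduced.isPosRoot_rootAt (hn : 1 ≤ n) {w : List (Fin (n + 1))} (hw : IsReduced n w)
    (k : Fin w.length) : IsPosRoot n (rootAt n w k) := by
  by_contra h
  obtain ⟨u₁, j, u₂, hu, hj⟩ := exists_split_of_not_isPosRoot hn (isPosRoot_simpleRoot hn _) _ h
  have hsplit : w = u₁ ++ j :: u₂ ++ w.get k :: w.drop (k.val + 1) := by
    rw [← hu]
    simp
  have hp : wordProd n (u₁ ++ u₂ ++ w.drop (k.val + 1)) = wordProd n w := by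
    conv_rhs => rw [hsplit]
    simp only [wordProd_append, wordProd_cons]
    have h2 : simpleReflection n j * simpleReflection n j = 1 :=
      LinearMap.ext fun v => simpleReflection_simpleReflection hn j v
    calc wordProd n u₁ * wordProd n u₂ * wordProd n (w.drop (k.val + 1))
        = wordProd n u₁ * (simpleReflection n j * simpleReflection n j) * wordProd n u₂
          * wordProd n (w.drop (k.val + 1)) := by rw [h2, mul_one]
      _ = wordProd n u₁ * (simpleReflection n j * (simpleReflection n j * wordProd n u₂))
          * wordProd n (w.drop (k.val + 1)) := by simp only [mul_assoc]
      _ = wordProd n u₁ * (simpleReflection n j * (wordProd n u₂ * simpleReflection n (w.get k)))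
          * wordProd n (w.drop (k.val + 1)) := by rw [wordProd_mul_simpleReflection hn hj]
      _ = wordProd n u₁ * (simpleReflection n j * wordProd n u₂) *
          (simpleReflection n (w.get k) * wordProd n (w.drop (k.val + 1))) := by
          simp only [mul_assoc]
  have := hw _ hp
  have hl := congrArg List.length hsplit
  simp only [List.length_append, List.length_cons] at this hl
  omega

theorem rootAt_cons_succ (i : Fin (n + 1)) (w : List (Fin (n + 1))) (k : Fin w.length) :
    rootAt n (i :: w) k.succ = simpleReflection n i (rootAt n w k) := by
  simp [rootAt]

/-- A positive root which is not the image of a positive root is one of the roots of the word. -/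
theorem exists_rootAt_eq (hn : 1 ≤ n) (w : List (Fin (n + 1))) {v : Lat n} (hv : IsPosRoot n v)
    (h : ∀ u, wordProd n w u = v → ¬ IsPosRoot n u) : ∃ k, rootAt n w k = v := by
  induction w generalizing v with
  | nil => exact absurd hv (h v rfl)
  | cons i w ih =>
    rcases hv.simpleReflection hn i with rfl | h'
    · exact ⟨⟨0, by simp⟩, by simp [rootAt]⟩
    · obtain ⟨k, hk⟩ := ih h' fun u hu => h u (by
        rw [wordProd_cons, Module.End.mul_apply, hu, simpleReflection_simpleReflection hn])
      exact ⟨k.succ, by rw [rootAt_cons_succ, hk, simpleReflection_simpleReflection hn]⟩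

theorem exists_rootAt_eq_of_neg (hn : 1 ≤ n) {w : List (Fin (n + 1))}
    (hw : ∀ β : Lat n, IsPosRoot n β → IsPosRoot n (-(wordProd n w β))) {v : Lat n}
    (hv : IsPosRoot n v) : ∃ k, rootAt n w k = v :=
  exists_rootAt_eq hn w hv fun u hu hpos => hv.not_neg (hu ▸ hw u hpos)

/-- Any word for the same element lists every positive root, so it has at least as many letters as
`w` has distinct positive roots. -/
theorem isReducedLongest_of_injective (hn : 1 ≤ n) {w : List (Fin (n + 1))}
    (hw : ∀ β : Lat n, IsPosRoot n β → IsPosRoot n (-(wordProd n w β)))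
    (hpos : ∀ k, IsPosRoot n (rootAt n w k)) (hinj : Function.Injective (rootAt n w)) :
    IsReducedLongest n w := by
  refine ⟨fun w' hw' => ?_, hw⟩
  choose f hf using fun k => exists_rootAt_eq_of_neg (w := w') hn (by rwa [hw']) (hpos k)
  have : Function.Injective f := fun a b hab => hinj (by rw [← hf a, ← hf b, hab])
  simpa using Fintype.card_le_of_injective f this

end TwistedD

namespace TwistedD

variable {n : ℕ}

/-! ### Height functions and adapted words -/

/-- A function whose values at adjacent orbits differ by one. -/
def IsHt (n : ℕ) (h : ℕ → ℤ) : Prop :=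
  ∀ a, 1 ≤ a → a + 1 ≤ n → h (a + 1) = h a + 1 ∨ h a = h (a + 1) + 1

/-- The orbit `a` is a local maximum of `h`. -/
def IsPeak (n : ℕ) (h : ℕ → ℤ) (a : ℕ) : Prop :=
  ∀ b, 1 ≤ b → b ≤ n → (b = a + 1 ∨ a = b + 1) → h b = h a - 1

/-- Lower the value of `h` at `a` by `2`. -/
def lower (h : ℕ → ℤ) (a : ℕ) : ℕ → ℤ := fun b => if b = a then h b - 2 else h b

/-- The head after popping the vertex `i`. -/
def nextHead (hd i : Fin (n + 1)) : Fin (n + 1) := if i = hd then vee n hd else hd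

/-- Adapted words in terms of a height function and a head. -/
def Ad : (ℕ → ℤ) → Fin (n + 1) → List (Fin (n + 1)) → Prop
  | _, _, [] => True
  | h, hd, i :: w => ((fold n i = n → i = hd) ∧ IsPeak n h (fold n i)) ∧
      Ad (lower h (fold n i)) (nextHead hd i) w

/-- The height function after a word. -/
def htAfter (h : ℕ → ℤ) (w : List (Fin (n + 1))) : ℕ → ℤ :=
  fun b => h b - 2 * ((w.map (fold n)).count b : ℤ)

/-- The head after a word. -/
def hdAfter : Fin (n + 1) → List (Fin (n + 1)) → Fin (n + 1)
  | hd, [] => hd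
  | hd, i :: w => hdAfter (nextHead hd i) w

@[simp] theorem htAfter_nil (h : ℕ → ℤ) : htAfter (n := n) h [] = h := by
  funext b; simp [htAfter]

theorem htAfter_cons (h : ℕ → ℤ) (i : Fin (n + 1)) (w : List (Fin (n + 1))) :
    htAfter h (i :: w) = htAfter (lower h (fold n i)) w := by
  funext b
  simp only [htAfter, lower, List.map_cons, List.count_cons, beq_iff_eq, @eq_comm _ b]
  split_ifs <;> push_cast <;> ring

theorem htAfter_append (h : ℕ → ℤ) (u v : List (Fin (n + 1))) :
    htAfter h (u ++ v) = htAfter (htAfter h u) v := by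
  funext b
  simp only [htAfter, List.map_append, List.count_append]
  push_cast; ring

theorem hdAfter_append (hd : Fin (n + 1)) (u v : List (Fin (n + 1))) :
    hdAfter hd (u ++ v) = hdAfter (hdAfter hd u) v := by
  induction u generalizing hd with
  | nil => rfl
  | cons i u ih => exact ih _

theorem ad_append {h : ℕ → ℤ} {hd : Fin (n + 1)} {u v : List (Fin (n + 1))} :
    Ad h hd (u ++ v) ↔ Ad h hd u ∧ Ad (htAfter h u) (hdAfter hd u) v := by
  induction u generalizing h hd with
  | nil => simp [Ad, hdAfter]
  | cons i u ih => simp only [List.cons_append, Ad, ih, htAfter_cons, hdAfter, and_assoc]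

theorem one_le_fold (hn : 1 ≤ n) (i : Fin (n + 1)) : 1 ≤ fold n i := by unfold fold; omega

theorem fold_le (i : Fin (n + 1)) : fold n i ≤ n := by unfold fold; omega

theorem fold_vee_eq (hn : 1 ≤ n) (i : Fin (n + 1)) : fold n (vee n i) = fold n i := by
  unfold vee fold
  split_ifs <;> simp <;> omega

theorem vee_vee (hn : 1 ≤ n) (i : Fin (n + 1)) : vee n (vee n i) = i := by
  unfold vee
  apply Fin.ext
  split_ifs <;> simp at * <;> omega

theorem vee_val_of_eq {i : Fin (n + 1)} (h : i.val = n) : (vee n i).val + 1 = n ∨ n = 0 := by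
  unfold vee
  simp [h]; omega

theorem vee_val_of_succ_eq {i : Fin (n + 1)} (h : i.val + 1 = n) : (vee n i).val = n := by
  have h2 : i.val ≠ n := by omega
  simp [vee, h, h2]

theorem fold_nextHead (hn : 1 ≤ n) {hd : Fin (n + 1)} (h : fold n hd = n) (i : Fin (n + 1)) :
    fold n (nextHead hd i) = n := by
  unfold nextHead
  split_ifs
  · rw [fold_vee_eq hn, h]
  · exact h

theorem IsHt.lower {h : ℕ → ℤ} (hh : IsHt n h) {a : ℕ} (ha1 : 1 ≤ a) (ha2 : a ≤ n)
    (ha : IsPeak n h a) : IsHt n (lower h a) := by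
  intro b hb1 hb2
  unfold TwistedD.lower
  have := hh b hb1 hb2
  by_cases h1 : b = a
  · have := ha (b + 1) (by omega) hb2 (by omega)
    subst h1
    simp
    omega
  · by_cases h2 : b + 1 = a
    · have := ha b hb1 (by omega) (by omega)
      subst h2
      simp
      omega
    · simp only [h1, h2, if_false]
      exact this

theorem IsHt.htAfter (hn : 1 ≤ n) {h : ℕ → ℤ} (hh : IsHt n h) {hd : Fin (n + 1)}
    {w : List (Fin (n + 1))} (hw : Ad h hd w) : IsHt n (htAfter h w) := by
  induction w generalizing h hd with
  | nil => simpa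
  | cons i w ih =>
    rw [htAfter_cons]
    exact ih (hh.lower (one_le_fold hn i) (fold_le i) hw.1.2) hw.2

theorem IsHt.abs_sub_le {h : ℕ → ℤ} (hh : IsHt n h) {a b : ℕ} (ha1 : 1 ≤ a) (ha2 : a ≤ n)
    (hb1 : 1 ≤ b) (hb2 : b ≤ n) : |h a - h b| ≤ |(a : ℤ) - b| := by
  wlog hab : a ≤ b generalizing a b
  · rw [abs_sub_comm, abs_sub_comm (a : ℤ)]
    exact this hb1 hb2 ha1 ha2 (by omega)
  induction b, hab using Nat.le_induction with
  | base => simp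
  | succ b hab ih =>
    have h1 := ih (by omega) (by omega)
    have h2 := hh b (by omega) hb2
    push_cast
    rw [abs_le] at *
    rw [abs_of_nonpos (by omega)] at *
    omega

theorem IsHt.parity {h : ℕ → ℤ} (hh : IsHt n h) {a : ℕ} (ha1 : 1 ≤ a) (ha2 : a ≤ n) :
    (h a - a) % 2 = (h 1 - 1) % 2 := by
  induction a, ha1 using Nat.le_induction with
  | base => simp
  | succ b hb ih =>
    have h1 := ih (by omega)
    have h2 := hh b hb ha2
    push_cast
    omega

/-- From a height function one reaches every smaller one of the same parity by popping sinks. -/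
theorem exists_ad_of_le (hn : 1 ≤ n) {h h' : ℕ → ℤ} (hh : IsHt n h) (hh' : IsHt n h')
    (hle : ∀ a, 1 ≤ a → a ≤ n → h' a ≤ h a)
    (hpar : ∀ a, 1 ≤ a → a ≤ n → 2 ∣ h a - h' a) {hd : Fin (n + 1)} (hhd : fold n hd = n) :
    ∃ w, Ad h hd w ∧ ∀ a, 1 ≤ a → a ≤ n → htAfter h w a = h' a := by
  obtain ⟨N, hN⟩ : ∃ N : ℕ, ∑ a ∈ Finset.Icc 1 n, (h a - h' a) = N :=
    ⟨(∑ a ∈ Finset.Icc 1 n, (h a - h' a)).toNat, by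
      rw [Int.toNat_of_nonneg]
      refine Finset.sum_nonneg fun a ha => ?_
      have := Finset.mem_Icc.1 ha
      linarith [hle a this.1 this.2]⟩
  induction N using Nat.strong_induction_on generalizing h hd with
  | _ N ih =>
    by_cases heq : ∀ a, 1 ≤ a → a ≤ n → h a = h' a
    · exact ⟨[], trivial, by simpa using heq⟩
    push Not at heq
    have hne : ((Finset.Icc 1 n).filter fun a => h a ≠ h' a).Nonempty := by
      obtain ⟨a, h1, h2, h3⟩ := heq
      exact ⟨a, by simp [h1, h2, h3]⟩
    -- The highest orbit where `h` and `h'` differ is a peak: a higher neighbour would have its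
    -- final height already, and `h'` would jump by more than one.
    obtain ⟨a, ha, hmax⟩ := Finset.exists_max_image _ h hne
    simp only [Finset.mem_filter, Finset.mem_Icc] at ha hmax
    obtain ⟨⟨ha1, ha2⟩, ha3⟩ := ha
    have hpeak : IsPeak n h a := by
      intro b hb1 hb2 hb
      have e1 : h b = h a + 1 ∨ h a = h b + 1 := by
        rcases hb with rfl | rfl
        · exact hh a ha1 hb2
        · exact (hh b hb1 ha2).symm
      have e2 : h' b = h' a + 1 ∨ h' a = h' b + 1 := by
        rcases hb with rfl | rfl
        · exact hh' a ha1 hb2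
        · exact (hh' b hb1 ha2).symm
      have e3 : h b = h' b ∨ h b ≤ h a := by
        by_cases e : h b = h' b
        · exact Or.inl e
        · exact Or.inr (hmax b ⟨⟨hb1, hb2⟩, e⟩)
      have := hle a ha1 ha2
      omega
    obtain ⟨i, hi, hihd⟩ : ∃ i : Fin (n + 1), fold n i = a ∧ (fold n i = n → i = hd) := by
      by_cases han : a = n
      · exact ⟨hd, by rw [hhd, han], fun _ => rfl⟩
      · refine ⟨⟨a - 1, by omega⟩, ?_, ?_⟩ <;> unfold fold <;> simp <;> omega
    have hlt : h' a + 2 ≤ h a := by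
      have := hle a ha1 ha2
      have := hpar a ha1 ha2
      omega
    have hsum : ∑ b ∈ Finset.Icc 1 n, (lower h a b - h' b) = N - 2 := by
      have : ∀ b ∈ Finset.Icc 1 n, lower h a b - h' b = (h b - h' b) + if b = a then -2 else 0 := by
        intro b _
        unfold lower
        split_ifs <;> ring
      rw [Finset.sum_congr rfl this, Finset.sum_add_distrib, hN, Finset.sum_ite_eq',
        if_pos (Finset.mem_Icc.2 ⟨ha1, ha2⟩)]
      ring
    have hN2 : 2 ≤ N := by
      have h0 : 0 ≤ ∑ b ∈ Finset.Icc 1 n, (lower h a b - h' b) := by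
        refine Finset.sum_nonneg fun b hb => ?_
        have := Finset.mem_Icc.1 hb
        have := hle b this.1 this.2
        unfold lower
        split_ifs with e
        · subst e; omega
        · omega
      omega
    obtain ⟨w, hw, hw'⟩ := ih (N - 2) (by omega) (hh.lower ha1 ha2 hpeak) (hd := nextHead hd i)
      (fun b hb1 hb2 => by
        have := hle b hb1 hb2
        unfold lower
        split_ifs with e
        · subst e; omega
        · omega)
      (fun b hb1 hb2 => by
        have := hpar b hb1 hb2
        unfold lower
        split_ifs with e
        · omega
        · omega)
      (fold_nextHead hn hhd i)
      (by rw [hsum]; omega)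
    refine ⟨i :: w, ⟨⟨hihd, hi ▸ hpeak⟩, hi ▸ hw⟩, ?_⟩
    rw [htAfter_cons, hi]
    exact hw'

theorem hdAfter_eq (hn : 1 ≤ n) {h : ℕ → ℤ} {hd : Fin (n + 1)} (hhd : fold n hd = n)
    {w : List (Fin (n + 1))} (hw : Ad h hd w) :
    hdAfter hd w = if Even ((w.map (fold n)).count n) then hd else vee n hd := by
  induction w generalizing h hd with
  | nil => simp [hdAfter]
  | cons i w ih =>
    rw [hdAfter, ih (fold_nextHead hn hhd i) hw.2, List.map_cons, List.count_cons, nextHead]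
    by_cases hi : fold n i = n
    · rw [if_pos (hw.1.1 hi), vee_vee hn]
      simp only [hi, beq_self_eq_true, if_true, Nat.even_add_one]
      split_ifs <;> rfl
    · have : i ≠ hd := fun e => hi (e ▸ hhd)
      simp [hi, this]

theorem Ad.congr {h h' : ℕ → ℤ} {C : ℤ} (hC : ∀ a, 1 ≤ a → a ≤ n → h' a = h a + C) (hn : 1 ≤ n)
    {hd : Fin (n + 1)} {w : List (Fin (n + 1))} (hw : Ad h hd w) : Ad h' hd w := by
  induction w generalizing h h' hd with
  | nil => trivial
  | cons i w ih =>
    refine ⟨⟨hw.1.1, fun b hb1 hb2 hb => ?_⟩, ih (fun a ha1 ha2 => ?_) hw.2⟩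
    · rw [hC b hb1 hb2, hC _ (one_le_fold hn i) (fold_le i), hw.1.2 b hb1 hb2 hb]
      ring
    · simp only [lower, hC a ha1 ha2]
      split_ifs <;> ring

theorem Ad.map_vee (hn : 1 ≤ n) {h : ℕ → ℤ} {hd : Fin (n + 1)} {w : List (Fin (n + 1))}
    (hw : Ad h hd w) : Ad h (vee n hd) (w.map (vee n)) := by
  induction w generalizing h hd with
  | nil => trivial
  | cons i w ih =>
    have hinj : vee n i = vee n hd ↔ i = hd :=
      ⟨fun e => by rw [← vee_vee hn i, e, vee_vee hn], fun e => by rw [e]⟩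
    have e : nextHead (vee n hd) (vee n i) = vee n (nextHead hd i) := by
      simp only [nextHead, hinj]
      split_ifs <;> rfl
    rw [List.map_cons, Ad, fold_vee_eq hn, hinj, e]
    exact ⟨hw.1, ih hw.2⟩

/-! ### Translation of quivers and adaptedness into height functions. -/

namespace TwistedQuiver

variable {Q : TwistedQuiver n} {ξ : ℕ → ℤ}

theorem IsHeight.isHt (hξ : Q.IsHeight ξ) : IsHt n ξ := by
  intro a ha1 ha2
  rcases Q.oriented a ha1 ha2 with ⟨h, -⟩ | ⟨h, -⟩
  · exact Or.inl (hξ _ _ h)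
  · exact Or.inr (hξ _ _ h)

theorem IsHeight.isSink_iff (hn : 1 ≤ n) (hξ : Q.IsHeight ξ) (i : Fin (n + 1)) :
    Q.IsSink i ↔ (fold n i = n → i = Q.head) ∧ IsPeak n ξ (fold n i) := by
  refine and_congr_right fun _ => ⟨fun h b hb1 hb2 hb => ?_, fun h b hb => ?_⟩
  · have hf := one_le_fold hn i
    have hf' := fold_le i
    have : Q.arrow b (fold n i) := by
      rcases hb with rfl | hb
      · exact (Q.oriented _ hf hb2).elim (fun h' => absurd h'.1 (h _)) fun h' => h'.1
      · rw [hb] at h hf' ⊢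
        exact (Q.oriented _ hb1 hf').elim (fun h' => h'.1) fun h' => absurd h'.1 (h _)
    rw [hξ _ _ this]
    ring
  · have h1 := Q.edge_of_arrow _ _ hb
    have h2 := hξ _ _ hb
    have h3 := h b (by omega) (by omega) (by omega)
    omega

theorem IsHeight.reflect (hξ : Q.IsHeight ξ) {i : Fin (n + 1)} (hi : Q.IsSink i) :
    (Q.reflect i).IsHeight (lower ξ (fold n i)) ∧ (Q.reflect i).head = nextHead Q.head i := by
  rw [TwistedQuiver.reflect, if_pos (Or.inl hi)]
  refine ⟨fun a b hab => ?_, rfl⟩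
  unfold lower
  simp only [flip] at hab
  split_ifs at hab with h
  · have h1 := hξ _ _ hab
    have h2 := Q.edge_of_arrow _ _ hab
    have h3 : b ≠ fold n i := fun e => hi.2 a (e ▸ hab)
    have h4 : a = fold n i := h.resolve_right h3
    rw [if_neg h3, if_pos h4]
    omega
  · rw [if_neg fun e => h (Or.inr e), if_neg fun e => h (Or.inl e)]
    exact hξ _ _ hab

/-- Sinks are peaks of the height function, and reflecting at a sink lowers it there by `2`. From
here on only heights and heads matter. -/
theorem IsHeight.adapted_iff (hn : 1 ≤ n) (hξ : Q.IsHeight ξ) (w : List (Fin (n + 1))) :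
    Q.Adapted w ↔ Ad ξ Q.head w := by
  induction w generalizing Q ξ with
  | nil => rfl
  | cons i w ih =>
    rw [Adapted, Ad, ← hξ.isSink_iff hn]
    refine and_congr_right fun hi => ?_
    rw [ih (hξ.reflect hi).1, (hξ.reflect hi).2]

end TwistedQuiver

end TwistedD

namespace TwistedD

variable {n : ℕ}

/-! ### Antiperiodic functions -/

/-- The antiperiodic function of antiperiod `L` which agrees with `g` on `[c, c + L)`. -/
def anti (L c : ℤ) (g : ℤ → ℤ) (z : ℤ) : ℤ :=
  if Even ((z - c) / L) then g (c + (z - c) % L) else -g (c + (z - c) % L)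

theorem anti_antiperiodic {L : ℤ} (hL : 0 < L) (c : ℤ) (g : ℤ → ℤ) :
    Function.Antiperiodic (anti L c g) L := by
  intro z
  have e1 : (z + L - c) / L = (z - c) / L + 1 := by
    rw [show z + L - c = z - c + L by ring, Int.add_ediv_of_dvd_right (dvd_refl L),
      Int.ediv_self hL.ne']
  have e2 : (z + L - c) % L = (z - c) % L := by
    rw [show z + L - c = z - c + L by ring, Int.add_emod_right]
  simp only [anti, e1, e2, Int.even_add_one]
  split_ifs <;> first | rfl | simp

theorem anti_of_mem {L c : ℤ} (g : ℤ → ℤ) {z : ℤ} (h1 : c ≤ z) (h2 : z < c + L) :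
    anti L c g z = g z := by
  have e1 : (z - c) / L = 0 := Int.ediv_eq_zero_of_lt (by omega) (by omega)
  have e2 : (z - c) % L = z - c := Int.emod_eq_of_lt (by omega) (by omega)
  rw [anti, e1, e2, if_pos (by decide), add_sub_cancel]

theorem anti_of_ge {L c : ℤ} (g : ℤ → ℤ) {z : ℤ} (h1 : c + L ≤ z) (h2 : z < c + 2 * L) :
    anti L c g z = - g (z - L) := by
  have := anti_antiperiodic (L := L) (by omega) c g (z - L)
  rw [sub_add_cancel] at this
  rw [this, anti_of_mem g (by omega) (by omega)]

theorem anti_of_lt {L c : ℤ} (g : ℤ → ℤ) {z : ℤ} (h1 : c - L ≤ z) (h2 : z < c) :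
    anti L c g z = - g (z + L) := by
  rw [← anti_of_mem (L := L) (c := c) (z := z + L) g (by omega) (by omega),
    anti_antiperiodic (by omega) c g z, neg_neg]

/-! ### Frames -/

/-- The position of the basis vector `ε_{v+1}` for the height function `h`. -/
def pos (n : ℕ) (h : ℕ → ℤ) (v : ℕ) : ℤ :=
  if v = 0 then h 1 + 1 else
    if v < n ∧ h (v + 1) = h v + 1 then h (v + 1) + (v + 1) else h v - v

/-- The sign of `ε_{v+1}`, which depends on the head. -/
def sgn (hd : Fin (n + 1)) (v : ℕ) : ℤ := if v = n ∧ hd.val = n then -1 else 1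

theorem sgn_mul_self (hd : Fin (n + 1)) (v : ℕ) : sgn hd v * sgn hd v = 1 := by
  unfold sgn; split_ifs <;> rfl

/-- The linear map `W` is given by the height function `h` and the head `hd`. -/
def IsFrame (x : ℤ → Lat n) (h : ℕ → ℤ) (hd : Fin (n + 1)) (W : Module.End ℤ (Lat n)) : Prop :=
  ∀ v : Fin (n + 1), W (eps v) = sgn hd v • x (pos n h v)

/-- The vector with coordinate `(a, p)`. -/
def rt (x : ℤ → Lat n) (a : ℕ) (p : ℤ) : Lat n := x (p + a) - x (p - a)

theorem pos_pred_of_isPeak {h : ℕ → ℤ} {v : ℕ} (hv : v < n)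
    (ha : IsPeak n h (v + 1)) : pos n h v = h (v + 1) + (v + 1) := by
  unfold pos
  split_ifs with h1 h2
  · subst h1; simp
  · rfl
  · have := ha v (by omega) (by omega) (by omega)
    omega

theorem pos_pred_lower {h : ℕ → ℤ} {v : ℕ} (hv : v < n)
    (ha : IsPeak n h (v + 1)) : pos n (lower h (v + 1)) v = h (v + 1) - (v + 1) := by
  unfold pos lower
  by_cases h1 : v = 0
  · subst h1; simp; ring
  · have := ha v (by omega) (by omega) (by omega)
    have e : ¬ (v < n ∧ h (v + 1) - 2 = h v + 1) := by omega
    simp [h1, e]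
    omega

theorem pos_of_isPeak {h : ℕ → ℤ} {a : ℕ} (ha1 : 1 ≤ a)
    (ha : IsPeak n h a) : pos n h a = h a - a := by
  unfold pos
  rw [if_neg (by omega), if_neg]
  rintro ⟨h1, h2⟩
  have := ha (a + 1) (by omega) (by omega) (by omega)
  omega

theorem pos_lower {h : ℕ → ℤ} {a : ℕ} (ha1 : 1 ≤ a) (ha2 : a < n)
    (ha : IsPeak n h a) : pos n (lower h a) a = h a + a := by
  have := ha (a + 1) (by omega) (by omega) (by omega)
  unfold pos lower
  have e : a < n ∧ h (a + 1) = h a - 2 + 1 := by omega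
  have e2 : a ≠ 0 := by omega
  simp [e, e2]
  ring

theorem pos_lower_last {h : ℕ → ℤ} (hn : 1 ≤ n) : pos n (lower h n) n = h n - 2 - n := by
  unfold pos lower
  have e2 : n ≠ 0 := by omega
  simp [e2]

theorem pos_lower_of_ne {h : ℕ → ℤ} {a v : ℕ} (h1 : v ≠ a) (h2 : v + 1 ≠ a) :
    pos n (lower h a) v = pos n h v := by
  unfold pos lower
  by_cases h0 : v = 0
  · subst h0; simp [h2]
  · simp [h0, h1, h2]

theorem nextHead_of_fold_lt {hd i : Fin (n + 1)} (hhd : fold n hd = n) (hi : fold n i < n) :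
    nextHead hd i = hd := by
  unfold nextHead
  rw [if_neg]
  rintro rfl
  omega

theorem sgn_of_lt (hd : Fin (n + 1)) {v : ℕ} (h : v < n) : sgn hd v = 1 := by
  unfold sgn; rw [if_neg (by omega)]

/-- At a peak `a < n` the positions with indices `a - 1` and `a` are `h a + a` and `h a - a`, and
lowering `h` at `a` swaps them, as `s_a` swaps the basis vectors. For `a = n` the position `h n + n`
becomes `h n + n - (2n+2)`; antiperiodicity gives a sign, which the switch of head in `sgn`
compensates. -/
theorem IsFrame.step (hn : 1 ≤ n) {x : ℤ → Lat n} (hx : Function.Antiperiodic x (2 * n + 2 : ℤ))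
    {h : ℕ → ℤ} {hd : Fin (n + 1)} (hhd : fold n hd = n) {W : Module.End ℤ (Lat n)}
    (hW : IsFrame x h hd W) {i : Fin (n + 1)} (hi : fold n i = n → i = hd)
    (hp : IsPeak n h (fold n i)) :
    IsFrame x (lower h (fold n i)) (nextHead hd i) (W * simpleReflection n i) := by
  intro v
  have hz : x (h n - 2 - n) = - x (h n + n) := by
    rw [← neg_neg (x (h n - 2 - n)), ← hx (h n - 2 - n)]
    congr 2; ring
  rw [Module.End.mul_apply]
  by_cases hin : i.val < n
  · have hf : fold n i = i.val + 1 := by unfold fold; omega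
    rw [hf] at hp ⊢
    by_cases h1 : v.val = i.val
    · have hv : v = i := Fin.ext h1
      subst hv
      rw [simpleReflection_eps_self v hin, hW, pos_pred_lower hin hp, sgn_of_lt _ hin]
      dsimp only
      rw [pos_of_isPeak (by omega) hp]
      by_cases h2 : v.val + 1 < n
      · rw [sgn_of_lt _ h2]; push_cast; rfl
      · have : v = hd := hi (by omega)
        have : sgn hd (v.val + 1) = 1 := by unfold sgn; rw [if_neg]; rw [← this]; omega
        rw [this]; push_cast; rfl
    by_cases h2 : v.val = i.val + 1
    · have hv : v = ⟨i.val + 1, by omega⟩ := Fin.ext h2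
      rw [hv, simpleReflection_eps_succ i hin, hW, sgn_of_lt _ hin, pos_pred_of_isPeak hin hp]
      dsimp only
      by_cases h3 : i.val + 1 < n
      · rw [sgn_of_lt _ h3, pos_lower (by omega) h3 hp]; push_cast; rfl
      · have hih : i = hd := hi (by omega)
        have h4 : i.val + 1 = n := by omega
        have : sgn (nextHead hd i) (i.val + 1) = -1 := by
          unfold sgn nextHead
          rw [if_pos hih, if_pos ⟨h4, vee_val_of_succ_eq (hih ▸ h4)⟩]
        rw [this, h4, pos_lower_last hn, hz, neg_smul, one_smul, one_smul, neg_neg]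
        congr 1
        omega
    · rw [simpleReflection_eps_of_ne i v hin h1 h2, hW, pos_lower_of_ne h2 (by omega)]
      congr 1
      by_cases h3 : i.val + 1 < n
      · rw [nextHead_of_fold_lt hhd (by omega)]
      · rw [sgn_of_lt _ (by omega), sgn_of_lt _ (by omega)]
  · have hin : i.val = n := by omega
    have hf : fold n i = n := by unfold fold; omega
    have hih := hi hf
    obtain ⟨m, hm⟩ : ∃ m : Fin (n + 1), m.val + 1 = n := ⟨⟨n - 1, by omega⟩, by simp; omega⟩
    rw [hf] at hp ⊢
    by_cases h1 : v = i
    · subst h1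
      rw [simpleReflection_last_eps_last v m hin hm, map_neg, hW, sgn_of_lt _ (by omega),
        pos_pred_of_isPeak (by omega) (by rwa [hm]), hin, pos_lower_last hn, hz]
      have : sgn (nextHead hd v) n = 1 := by
        unfold sgn nextHead
        rw [if_pos hih, if_neg]
        have := vee_val_of_eq (hih ▸ hin)
        omega
      rw [this, one_smul, one_smul, hm]
      congr 2
      omega
    by_cases h2 : v = m
    · subst h2
      have e := pos_pred_lower (h := h) (show v.val < n by omega) (by rwa [hm])
      rw [hm] at e
      have : sgn hd n = -1 := by unfold sgn; rw [← hih, if_pos ⟨rfl, hin⟩]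
      rw [simpleReflection_last_eps_pred i v hin hm, map_neg, hW, hin, e,
        pos_of_isPeak hn hp, this, sgn_of_lt _ (by omega), neg_smul, one_smul, one_smul, neg_neg]
      congr 1
      omega
    · have h3 : v.val ≠ i.val := fun e => h1 (Fin.ext e)
      have h4 : v.val ≠ m.val := fun e => h2 (Fin.ext e)
      rw [simpleReflection_last_eps_of_lt hn i v hin (by omega), hW,
        pos_lower_of_ne (by omega) (by omega), sgn_of_lt _ (by omega), sgn_of_lt _ (by omega)]

theorem IsFrame.apply_simpleRoot (hn : 1 ≤ n) {x : ℤ → Lat n}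
    {h : ℕ → ℤ} {hd : Fin (n + 1)} {W : Module.End ℤ (Lat n)}
    (hW : IsFrame x h hd W) {i : Fin (n + 1)} (hi : fold n i = n → i = hd)
    (hp : IsPeak n h (fold n i)) :
    W (simpleRoot n i) = rt x (fold n i) (h (fold n i)) := by
  unfold rt
  by_cases hin : i.val < n
  · have hf : fold n i = i.val + 1 := by unfold fold; omega
    rw [hf] at hp ⊢
    rw [simpleRoot_of_lt i hin, map_sub, hW, hW, pos_pred_of_isPeak hin hp, sgn_of_lt _ hin]
    dsimp only
    rw [pos_of_isPeak (by omega) hp]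
    have : sgn hd (i.val + 1) = 1 := by
      unfold sgn; rw [if_neg]; rintro ⟨h1, h2⟩
      have := hi (by omega)
      rw [← this] at h2
      omega
    rw [this]; push_cast; simp
  · have hin : i.val = n := by omega
    have hf : fold n i = n := by unfold fold; omega
    have hih := hi hf
    rw [hf] at hp ⊢
    have e := pos_pred_of_isPeak (n := n) (h := h) (v := n - 1) (by omega)
      (by rwa [Nat.sub_add_cancel hn])
    rw [Nat.sub_add_cancel hn] at e
    have : sgn hd n = -1 := by unfold sgn; rw [← hih, if_pos ⟨rfl, hin⟩]
    rw [simpleRoot_of_eq hn i hin, map_add, hW, hW, hin, this, pos_of_isPeak hn hp,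
      sgn_of_lt _ (by simp; omega)]
    dsimp only
    rw [e, neg_smul, one_smul, one_smul, sub_eq_add_neg]
    congr 2
    omega

theorem IsFrame.word (hn : 1 ≤ n) {x : ℤ → Lat n} (hx : Function.Antiperiodic x (2 * n + 2 : ℤ))
    {h : ℕ → ℤ} {hd : Fin (n + 1)} (hhd : fold n hd = n) {W : Module.End ℤ (Lat n)}
    (hW : IsFrame x h hd W) {w : List (Fin (n + 1))} (hw : Ad h hd w) :
    IsFrame x (htAfter h w) (hdAfter hd w) (W * wordProd n w) := by
  induction w generalizing h hd W with
  | nil => simpa [hdAfter] using hW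
  | cons i w ih =>
    rw [htAfter_cons, wordProd_cons, ← mul_assoc]
    exact ih (fold_nextHead hn hhd i) (hW.step hn hx hhd hw.1.1 hw.1.2) hw.2

theorem Ad.at {h : ℕ → ℤ} {hd : Fin (n + 1)} {w : List (Fin (n + 1))} (hw : Ad h hd w)
    (k : Fin w.length) : Ad h hd (w.take k) ∧
      (fold n (w.get k) = n → w.get k = hdAfter hd (w.take k)) ∧
      IsPeak n (htAfter h (w.take k)) (fold n (w.get k)) := by
  have e : w = w.take k ++ w.get k :: w.drop (k.val + 1) := by simp
  rw [e, ad_append] at hw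
  exact ⟨hw.1, hw.2.1⟩

theorem IsFrame.rootAt (hn : 1 ≤ n) {x : ℤ → Lat n} (hx : Function.Antiperiodic x (2 * n + 2 : ℤ))
    {h : ℕ → ℤ} {hd : Fin (n + 1)} (hhd : fold n hd = n) (hW : IsFrame x h hd 1)
    {w : List (Fin (n + 1))} (hw : Ad h hd w) (k : Fin w.length) :
    TwistedD.rootAt n w k = rt x (fold n (w.get k)) (htAfter h (w.take k) (fold n (w.get k))) := by
  have hk := hw.at k
  have := (hW.word hn hx hhd hk.1).apply_simpleRoot hn hk.2.1 hk.2.2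
  rwa [one_mul] at this

/-! ### Existence of a frame -/

/-- The positions with index below `b` lie in the half-open interval `(h b - b, h b + b]`. Passing
from `b` to `b + 1` adds one place to it, on the right or on the left according to the direction of
the step of `h`; this is the origin of the case distinction in `pos`. -/
theorem pos_mem {h : ℕ → ℤ} (hh : IsHt n h) {v b : ℕ} (hvb : v < b) (hb : b ≤ n) :
    h b - b < pos n h v ∧ pos n h v ≤ h b + b := by
  induction b, (show v + 1 ≤ b from hvb) using Nat.le_induction with
  | base =>
    unfold pos
    split_ifs with h1 h2
    · subst h1; constructor <;> simp
    · push_cast; omega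
    · have := hh v (by omega) (by omega)
      push_cast; omega
  | succ b hb' ih =>
    have h1 := ih (by omega) (by omega)
    have h2 := hh b (by omega) hb
    push_cast
    omega

theorem pos_sub_pos {h : ℕ → ℤ} (hh : IsHt n h) {v b : ℕ} (hvb : v < b) (hb : b ≤ n) :
    pos n h v ≠ pos n h b ∧ pos n h v - pos n h b < 2 * n + 2 ∧
      pos n h b - pos n h v < 2 * n + 2 := by
  have h1 := pos_mem hh hvb hb
  have h2 : pos n h b = h b - b ∨ pos n h b = h b + b + 2 := by
    unfold pos
    rw [if_neg (by omega)]
    split_ifs <;> omega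
  omega

/-- The converse of `pos_mem`: within the parity class the interval is filled completely. -/
theorem exists_pos_eq {h : ℕ → ℤ} (hh : IsHt n h) {b : ℕ} (hb1 : 1 ≤ b) (hb2 : b ≤ n) {z : ℤ}
    (hz1 : h b - b < z) (hz2 : z ≤ h b + b) (hz : 2 ∣ z - (h 1 + 1)) :
    ∃ v, v < b ∧ pos n h v = z := by
  induction b, hb1 using Nat.le_induction with
  | base => exact ⟨0, by omega, by simp [pos]; push_cast at *; omega⟩
  | succ b hb ih =>
    have h1 := hh b hb hb2
    have h3 := hh.parity (a := b) hb (by omega)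
    by_cases h2 : h b - b < z ∧ z ≤ h b + b
    · obtain ⟨v, hv, e⟩ := ih (by omega) h2.1 h2.2
      exact ⟨v, by omega, e⟩
    · refine ⟨b, by omega, ?_⟩
      unfold pos
      rw [if_neg (by omega)]
      push_cast at hz1 hz2
      split_ifs <;> omega

/-- To prove a periodic property on a parity class, it is enough to check it at the positions. -/
theorem pos_induction (hn : 1 ≤ n) {h : ℕ → ℤ} (hh : IsHt n h) {P : ℤ → Prop}
    (hP : ∀ z, P (z + (2 * n + 2)) ↔ P z) (hpos : ∀ v : Fin (n + 1), P (pos n h v)) {z : ℤ}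
    (hz : 2 ∣ z - (h 1 + 1)) : P z := by
  have hper : Function.Periodic P (2 * n + 2 : ℤ) := fun z => propext (hP z)
  set L : ℤ := 2 * n + 2 with hL
  set y := h n - n + (z - (h n - n)) % L with hy
  have e1 := hper.sub_int_mul_eq (x := z) ((z - (h n - n)) / L)
  rw [Int.cast_id] at e1
  have e2 := Int.mul_ediv_add_emod (z - (h n - n)) L
  rw [show z - ((z - (h n - n)) / L : ℤ) * L = y by rw [hy]; linarith] at e1
  rw [← e1]
  have hL0 : 0 < L := by omega
  have e3 := Int.emod_nonneg (z - (h n - n)) hL0.ne'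
  have e4 := Int.emod_lt_of_pos (z - (h n - n)) hL0
  have e5 := hh.parity hn le_rfl
  have e6 : 2 ∣ y - (h 1 + 1) := by
    have : y = z - L * ((z - (h n - n)) / L) := by rw [hy]; linarith
    rw [this, hL]
    obtain ⟨c, hc⟩ := hz
    exact ⟨c - (n + 1) * ((z - (h n - n)) / (2 * n + 2)), by linarith⟩
  -- `y` is the representative of `z` in the window of length `2n+2` starting at `h n - n`. The left
  -- end is the position of the last basis vector, and the other points of the window are covered by
  -- `exists_pos_eq`.
  by_cases h0 : y = h n - n
  · have := hpos (Fin.last n)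
    have e : pos n h n = h n - n := by
      unfold pos; rw [if_neg (by omega), if_neg (by omega)]
    rwa [Fin.val_last, e, ← h0] at this
  · obtain ⟨v, hv, e⟩ := exists_pos_eq hh hn le_rfl (z := y) (by omega) (by omega) e6
    rw [← e]
    exact hpos ⟨v, by omega⟩

/-- The standard frame of a height function. -/
def frame (h : ℕ → ℤ) (hd : Fin (n + 1)) (z : ℤ) : Lat n := fun v =>
  sgn hd v * anti (2 * n + 2) (pos n h v) (fun y => if y = pos n h v then 1 else 0) z

theorem frame_antiperiodic (h : ℕ → ℤ) (hd : Fin (n + 1)) :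
    Function.Antiperiodic (frame h hd) (2 * n + 2 : ℤ) := by
  intro z
  funext v
  simp only [frame, Pi.neg_apply]
  rw [anti_antiperiodic (by omega) _ _ z]
  ring

theorem frame_pos {h : ℕ → ℤ} (hh : IsHt n h) (hd : Fin (n + 1)) (v : Fin (n + 1)) :
    frame h hd (pos n h v) = sgn hd v • eps v := by
  funext b
  simp only [frame, Pi.smul_apply, smul_eq_mul, eps, Pi.single_apply]
  by_cases hb : b = v
  · subst hb
    rw [anti_of_mem _ le_rfl (by omega)]
    simp
  · have hne : pos n h v ≠ pos n h b ∧ pos n h v - pos n h b < 2 * n + 2 ∧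
      pos n h b - pos n h v < 2 * n + 2 := by
      rcases lt_or_gt_of_ne hb with hlt | hlt
      · have := pos_sub_pos hh (Fin.lt_def.1 hlt) (by omega)
        omega
      · have := pos_sub_pos hh (Fin.lt_def.1 hlt) (by omega)
        omega
    rw [if_neg hb]
    rcases lt_or_ge (pos n h v) (pos n h b) with hlt | hge
    · rw [anti_of_lt _ (by omega) hlt, if_neg (by omega)]; simp
    · rw [anti_of_mem _ hge (by omega), if_neg hne.1]; simp

theorem isFrame_frame {h : ℕ → ℤ} (hh : IsHt n h) (hd : Fin (n + 1)) :
    IsFrame (frame h hd) h hd 1 := by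
  intro v
  rw [frame_pos hh, smul_smul, sgn_mul_self, one_smul]
  rfl

/-- The frame vectors over one antiperiod form a basis up to signs, so the values of a functional on
them are arbitrary. Linear relations between roots thus become identities for all antiperiodic
functions. -/
theorem exists_functional (hn : 1 ≤ n) {h : ℕ → ℤ} (hh : IsHt n h) (hd : Fin (n + 1)) {f : ℤ → ℤ}
    (hf : Function.Antiperiodic f (2 * n + 2 : ℤ)) :
    ∃ F : Lat n →ₗ[ℤ] ℤ, ∀ z, 2 ∣ z - (h 1 + 1) → F (frame h hd z) = f z := by
  refine ⟨∑ v : Fin (n + 1), (sgn hd v * f (pos n h v)) • LinearMap.proj v, fun z hz => ?_⟩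
  refine pos_induction hn hh (P := fun z => (∑ v : Fin (n + 1),
    (sgn hd v * f (pos n h v)) • LinearMap.proj v : Lat n →ₗ[ℤ] ℤ) (frame h hd z) = f z) (fun z => ?_) (fun v => ?_) hz
  · rw [frame_antiperiodic h hd z, hf z, map_neg, neg_inj]
  · rw [frame_pos hh]
    simp only [LinearMap.sum_apply, LinearMap.smul_apply, LinearMap.proj_apply, Pi.smul_apply,
      smul_eq_mul, eps, Pi.single_apply]
    rw [Finset.sum_eq_single v]
    · rw [if_pos rfl, mul_one, mul_right_comm, sgn_mul_self, one_mul]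
    · intro b _ hb; rw [if_neg hb, mul_zero, mul_zero]
    · simp

theorem frame_dotProduct (hn : 1 ≤ n) {h : ℕ → ℤ} (hh : IsHt n h) (hd : Fin (n + 1)) {y z : ℤ}
    (hy : 2 ∣ y - (h 1 + 1)) (hz : 2 ∣ z - (h 1 + 1)) (h1 : y - z < 2 * (2 * n + 2))
    (h2 : z - y < 2 * (2 * n + 2)) :
    frame h hd y ⬝ᵥ frame h hd z =
      if z = y then 1 else if z = y + (2 * n + 2) ∨ y = z + (2 * n + 2) then -1 else 0 := by
  set L : ℤ := 2 * n + 2 with hL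
  have hL0 : 0 < L := by omega
  set e : ℤ → ℤ := anti L 0 (fun t => if t = 0 then 1 else 0) with he
  have hanti : Function.Antiperiodic e L := anti_antiperiodic hL0 _ _
  have hmain : frame h hd y ⬝ᵥ frame h hd z = e (z - y) := by
    refine pos_induction hn hh (P := fun z => frame h hd y ⬝ᵥ frame h hd z = e (z - y))
      (fun z => ?_) (fun v => ?_) hz
    · rw [frame_antiperiodic h hd z, dotProduct_neg, add_sub_right_comm, ← hL, hanti (z - y),
        neg_inj]
    · refine pos_induction hn hh
        (P := fun y => frame h hd y ⬝ᵥ frame h hd (pos n h v) = e (pos n h v - y))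
        (fun y => ?_) (fun b => ?_) hy
      · rw [frame_antiperiodic h hd y, neg_dotProduct, ← hL, ← sub_sub, hanti.sub_eq, neg_inj]
      · rw [frame_pos hh, frame_pos hh, smul_dotProduct, dotProduct_smul, single_one_dotProduct]
        simp only [eps, smul_eq_mul, Pi.single_apply]
        by_cases hb : b = v
        · subst hb
          rw [if_pos rfl, mul_one, sgn_mul_self, sub_self, he, anti_of_mem _ le_rfl (by omega)]
          rfl
        · have hne : pos n h v ≠ pos n h b ∧ pos n h v - pos n h b < L ∧
              pos n h b - pos n h v < L := by
            rcases lt_or_gt_of_ne hb with hlt | hlt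
            · have := pos_sub_pos hh (Fin.lt_def.1 hlt) (by omega)
              omega
            · have := pos_sub_pos hh (Fin.lt_def.1 hlt) (by omega)
              omega
          rw [if_neg hb, mul_zero, mul_zero, he]
          rcases lt_or_ge (pos n h v) (pos n h b) with hlt | hge
          · rw [anti_of_lt _ (by omega) (by omega), if_neg (by omega)]; simp
          · rw [anti_of_mem _ (by omega) (by omega), if_neg (by omega)]
  rw [hmain]
  rcases lt_or_ge (z - y) 0 with h3 | h3
  · rcases lt_or_ge (z - y) (-L) with h4 | h4
    · have := hanti (z - y)
      rw [← neg_neg (e (z - y)), ← this, he, anti_of_lt _ (by omega) (by omega)]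
      split_ifs <;> omega
    · rw [he, anti_of_lt _ (by omega) (by omega)]
      split_ifs <;> omega
  · rcases lt_or_ge (z - y) L with h4 | h4
    · rw [he, anti_of_mem _ (by omega) (by omega)]
      split_ifs <;> omega
    · rw [he, anti_of_ge _ (by omega) (by omega)]
      split_ifs <;> omega

end TwistedD

namespace TwistedD

variable {n : ℕ}

/-! ### Coordinates of the positive roots -/

/-- The pairs `(a, p)` which occur as coordinates of positive roots. -/
structure Lab (n : ℕ) (h : ℕ → ℤ) (a : ℕ) (p : ℤ) : Prop where
  one_le : 1 ≤ a
  le : a ≤ n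
  lower_le : h a - 2 * n ≤ p
  le_ht : p ≤ h a
  parity : 2 ∣ h a - p

theorem IsHt.le_add {h : ℕ → ℤ} (hh : IsHt n h) {a b : ℕ} (ha1 : 1 ≤ a) (ha2 : a ≤ n)
    (hb1 : 1 ≤ b) (hb2 : b ≤ n) : h a ≤ h b + (a - b) ∨ h a ≤ h b + (b - a) := by
  have := hh.abs_sub_le ha1 ha2 hb1 hb2
  have h2 := (abs_le.1 this).2
  rcases abs_cases ((a : ℤ) - b) with h3 | h3 <;> omega

/-- The inner product of the frame vectors at positions `y` and `z`, for `|y - z| < 4 n + 4`. -/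
def pair (n : ℕ) (y z : ℤ) : ℤ :=
  if z = y then 1 else if z = y + (2 * n + 2) ∨ y = z + (2 * n + 2) then -1 else 0

theorem Lab.dvd {h : ℕ → ℤ} (hh : IsHt n h) {a : ℕ} {p : ℤ} (hl : Lab n h a p) :
    2 ∣ p + a - (h 1 + 1) ∧ 2 ∣ p - a - (h 1 + 1) := by
  have h1 := hh.parity hl.one_le hl.le
  have h2 := hl.parity
  omega

theorem rt_dotProduct (hn : 1 ≤ n) {h : ℕ → ℤ} (hh : IsHt n h) (hd : Fin (n + 1)) {a b : ℕ}
    {p q : ℤ} (ha : Lab n h a p) (hb : Lab n h b q) :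
    rt (frame h hd) a p ⬝ᵥ rt (frame h hd) b q = pair n (p + a) (q + b) - pair n (p + a) (q - b)
      - pair n (p - a) (q + b) + pair n (p - a) (q - b) := by
  have h1 := hh.le_add ha.one_le ha.le hb.one_le hb.le
  have h2 := hh.le_add hb.one_le hb.le ha.one_le ha.le
  have da := ha.dvd hh
  have db := hb.dvd hh
  obtain ⟨a1, a2, a3, a4, -⟩ := ha
  obtain ⟨b1, b2, b3, b4, -⟩ := hb
  unfold rt pair
  rw [sub_dotProduct, dotProduct_sub, dotProduct_sub,
    frame_dotProduct hn hh hd da.1 db.1 (by omega) (by omega),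
    frame_dotProduct hn hh hd da.1 db.2 (by omega) (by omega),
    frame_dotProduct hn hh hd da.2 db.1 (by omega) (by omega),
    frame_dotProduct hn hh hd da.2 db.2 (by omega) (by omega)]
  ring

theorem rt_dotProduct_self (hn : 1 ≤ n) {h : ℕ → ℤ} (hh : IsHt n h) (hd : Fin (n + 1)) {a : ℕ}
    {p : ℤ} (ha : Lab n h a p) : rt (frame h hd) a p ⬝ᵥ rt (frame h hd) a p = 2 := by
  rw [rt_dotProduct hn hh hd ha ha]
  obtain ⟨a1, a2, a3, a4, -⟩ := ha
  unfold pair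
  rw [if_pos rfl, if_pos rfl, if_neg (by omega), if_neg (by omega), if_neg (by omega),
    if_neg (by omega)]
  norm_num

/-- Equal roots have inner product `2`, which forces both pairs of endpoints to coincide; the bounds
`a, b ≤ n` exclude coincidences modulo the antiperiod. -/
theorem Lab.unique (hn : 1 ≤ n) {h : ℕ → ℤ} (hh : IsHt n h) {hd : Fin (n + 1)} {a b : ℕ}
    {p q : ℤ} (ha : Lab n h a p) (hb : Lab n h b q)
    (e : rt (frame h hd) a p = rt (frame h hd) b q) : a = b ∧ p = q := by
  have h1 := rt_dotProduct_self hn hh hd ha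
  nth_rewrite 2 [e] at h1
  rw [rt_dotProduct hn hh hd ha hb] at h1
  obtain ⟨a1, a2, a3, a4, -⟩ := ha
  obtain ⟨b1, b2, b3, b4, -⟩ := hb
  unfold pair at h1
  split_ifs at h1 <;> omega

/-- Negation is a shift of the second coordinate by `2n+2`, while the labels of one orbit span only
`2n`. -/
theorem Lab.ne_neg (hn : 1 ≤ n) {h : ℕ → ℤ} (hh : IsHt n h) {hd : Fin (n + 1)} {a b : ℕ}
    {p q : ℤ} (ha : Lab n h a p) (hb : Lab n h b q) :
    -rt (frame h hd) a p ≠ rt (frame h hd) b q := by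
  intro e
  have h1 := rt_dotProduct_self hn hh hd ha
  rw [← neg_neg (_ ⬝ᵥ _), ← dotProduct_neg, e, rt_dotProduct hn hh hd ha hb] at h1
  have h2 := hh.le_add ha.one_le ha.le hb.one_le hb.le
  have h3 := hh.le_add hb.one_le hb.le ha.one_le ha.le
  obtain ⟨a1, a2, a3, a4, -⟩ := ha
  obtain ⟨b1, b2, b3, b4, -⟩ := hb
  unfold pair at h1
  split_ifs at h1 <;> omega

theorem rt_add {x : ℤ → Lat n} (hx : Function.Antiperiodic x (2 * n + 2 : ℤ)) (a : ℕ) (p : ℤ) :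
    rt x a (p + (2 * n + 2)) = - rt x a p := by
  unfold rt
  rw [add_right_comm, hx, add_sub_right_comm, hx]
  abel

/-! ### The labels of the letters of a word -/

/-- The second coordinate of the `k`-th letter of a word. -/
def lbl (h : ℕ → ℤ) (w : List (Fin (n + 1))) (k : Fin w.length) : ℤ :=
  htAfter h (w.take k.val) (fold n (w.get k))

theorem htAfter_take_anti (h : ℕ → ℤ) (w : List (Fin (n + 1))) {k l : ℕ} (hkl : k ≤ l) (a : ℕ) :
    htAfter h (w.take l) a ≤ htAfter h (w.take k) a := by
  have : ((w.take k).map (fold n)).count a ≤ ((w.take l).map (fold n)).count a :=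
    ((List.take_sublist_take_left hkl).map _).count_le _
  unfold htAfter
  omega

theorem htAfter_le (h : ℕ → ℤ) (w : List (Fin (n + 1))) (k : ℕ) (a : ℕ) :
    htAfter h w a ≤ htAfter h (w.take k) a := by
  have : ((w.take k).map (fold n)).count a ≤ (w.map (fold n)).count a :=
    ((List.take_sublist k w).map _).count_le _
  unfold htAfter
  omega

theorem htAfter_take_succ (h : ℕ → ℤ) (w : List (Fin (n + 1))) (k : Fin w.length) :
    htAfter h (w.take (k.val + 1)) (fold n (w.get k)) = lbl h w k - 2 := by
  have : w.take (k.val + 1) = w.take k.val ++ [w.get k] := by simp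
  rw [this, htAfter_append, lbl]
  simp [htAfter]

theorem lbl_lt (h : ℕ → ℤ) (w : List (Fin (n + 1))) {k l : Fin w.length} (hkl : k < l)
    (hf : fold n (w.get k) = fold n (w.get l)) : lbl h w l < lbl h w k := by
  have h1 := htAfter_take_succ h w k
  have h2 := htAfter_take_anti h w (Nat.succ_le_of_lt (Fin.lt_def.1 hkl)) (fold n (w.get k))
  rw [Nat.succ_eq_add_one, h1, hf] at h2
  change lbl h w l ≤ _ at h2
  omega

theorem lbl_injective (h : ℕ → ℤ) (w : List (Fin (n + 1))) {k l : Fin w.length}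
    (hf : fold n (w.get k) = fold n (w.get l)) (he : lbl h w k = lbl h w l) : k = l := by
  rcases lt_trichotomy k l with hkl | hkl | hkl
  · have := lbl_lt h w hkl hf; omega
  · exact hkl
  · have := lbl_lt h w hkl hf.symm; omega

theorem lab_of_htAfter_eq (hn : 1 ≤ n) {h : ℕ → ℤ} {w : List (Fin (n + 1))}
    (hw : ∀ a, 1 ≤ a → a ≤ n → h a - (2 * n + 2) ≤ htAfter h w a) (k : Fin w.length) :
    Lab n h (fold n (w.get k)) (lbl h w k) := by
  have h1 := one_le_fold hn (w.get k)
  have h2 := fold_le (w.get k)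
  refine ⟨h1, h2, ?_, ?_, ?_⟩
  · have h3 := htAfter_take_succ h w k
    have h4 := htAfter_le h w (k.val + 1) (fold n (w.get k))
    have h5 := hw _ h1 h2
    omega
  · unfold lbl htAfter; omega
  · unfold lbl htAfter; omega

/-- Each visit lowers the height by `2`, so no value of the right parity is skipped on the way down.
-/
theorem exists_lbl_eq (h : ℕ → ℤ) (w : List (Fin (n + 1))) {a m : ℕ}
    (hm : htAfter h w a < h a - 2 * m) :
    ∃ k : Fin w.length, fold n (w.get k) = a ∧ lbl h w k = h a - 2 * m := by
  induction w using List.reverseRecOn with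
  | nil => simp at hm; omega
  | append_singleton w i ih =>
    rcases lt_or_ge (htAfter h w a) (h a - 2 * m) with h1 | h1
    · obtain ⟨k, hk, hk'⟩ := ih h1
      refine ⟨⟨k.val, by simp⟩, ?_, ?_⟩
      · simpa using hk
      · rw [← hk']
        unfold lbl
        simp [List.take_append_of_le_length k.2.le]
    · have e : fold n i = a ∧ htAfter h w a = h a - 2 * m := by
        rw [htAfter_append] at hm
        simp only [htAfter, List.map_cons, List.map_nil, List.count_singleton, beq_iff_eq] at hm h1 ⊢
        split_ifs at hm with e
        · exact ⟨e, by omega⟩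
        · omega
      refine ⟨⟨w.length, by simp⟩, ?_, ?_⟩
      · simpa using e.1
      · unfold lbl
        simp [e]

/-! ### Adapted words lowering every height by `2n+2`, and the orders they induce. -/

theorem pos_congr (hn : 1 ≤ n) {h h' : ℕ → ℤ} {C : ℤ} (hC : ∀ a, 1 ≤ a → a ≤ n → h' a = h a + C)
    {v : ℕ} (hv : v ≤ n) : pos n h' v = pos n h v + C := by
  unfold pos
  by_cases h0 : v = 0
  · rw [if_pos h0, if_pos h0, hC 1 le_rfl hn]; ring
  · rw [if_neg h0, if_neg h0, hC v (by omega) hv]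
    by_cases hvn : v < n
    · rw [hC (v + 1) (by omega) hvn]
      split_ifs <;> omega
    · rw [if_neg (by omega), if_neg (by omega)]
      ring

/-- All positions move by one antiperiod, so the word acts by `-1` on every basis vector except
possibly the last, whose sign depends on the final head. Either sign there sends positive roots to
negative ones. -/
theorem isPosRoot_neg_wordProd (hn : 1 ≤ n) {h : ℕ → ℤ} (hh : IsHt n h) {hd : Fin (n + 1)}
    (hhd : fold n hd = n) {w : List (Fin (n + 1))} (hw : Ad h hd w)
    (hw' : ∀ a, 1 ≤ a → a ≤ n → htAfter h w a = h a - (2 * n + 2)) (v : Lat n)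
    (hv : IsPosRoot n v) : IsPosRoot n (-wordProd n w v) := by
  have hx := frame_antiperiodic (n := n) h hd
  have hW := (isFrame_frame hh hd).word hn hx hhd hw
  rw [one_mul] at hW
  have key : ∀ v : Fin (n + 1), wordProd n w (eps v) =
      -((sgn (hdAfter hd w) v * sgn hd v) • eps v) := by
    intro v
    rw [hW v, pos_congr (h := h) (C := -(2 * n + 2)) hn
      (fun a h1 h2 => by rw [hw' a h1 h2]; ring) (by omega), ← sub_eq_add_neg, hx.sub_eq,
      frame_pos hh, smul_neg, smul_smul]
  have key' : ∀ v : Fin (n + 1), v.val < n → wordProd n w (eps v) = - eps v := by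
    intro v hv
    rw [key, sgn_of_lt _ hv, sgn_of_lt _ hv, one_mul, one_smul]
  have key2 : ∀ v : Fin (n + 1), wordProd n w (eps v) = - eps v ∨ wordProd n w (eps v) = eps v := by
    intro v
    have : sgn (hdAfter hd w) v * sgn hd v = 1 ∨ sgn (hdAfter hd w) v * sgn hd v = -1 := by
      unfold sgn; split_ifs <;> simp
    rcases this with e | e
    · left; rw [key, e, one_smul]
    · right; rw [key, e, neg_smul, one_smul, neg_neg]
  obtain ⟨a, b, hab, rfl | rfl⟩ := hv
  · rw [map_sub, key' a (by have := Fin.lt_def.1 hab; omega)]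
    rcases key2 b with e | e <;> rw [e]
    · rw [neg_sub, sub_neg_eq_add, neg_add_eq_sub]
      exact isPosRoot_sub hab
    · rw [neg_sub, sub_neg_eq_add, add_comm]
      exact isPosRoot_add hab.ne
  · rw [map_add, key' a (by have := Fin.lt_def.1 hab; omega)]
    rcases key2 b with e | e <;> rw [e]
    · rw [neg_add, neg_neg, neg_neg]
      exact isPosRoot_add hab.ne
    · rw [neg_add, neg_neg, ← sub_eq_add_neg]
      exact isPosRoot_sub hab

theorem isHt_sub {h : ℕ → ℤ} (hh : IsHt n h) (C : ℤ) : IsHt n (fun a => h a - C) := by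
  intro a h1 h2
  have := hh a h1 h2
  dsimp only
  omega

theorem exists_lab_of_isPosRoot (hn : 1 ≤ n) {h : ℕ → ℤ} (hh : IsHt n h) {hd : Fin (n + 1)}
    (hhd : fold n hd = n) {v : Lat n} (hv : IsPosRoot n v) :
    ∃ a p, Lab n h a p ∧ v = rt (frame h hd) a p := by
  obtain ⟨w, hw, hw'⟩ := exists_ad_of_le hn hh (isHt_sub hh (2 * n + 2)) (fun a _ _ => by omega)
    (fun a _ _ => by omega) hhd
  obtain ⟨k, hk⟩ := exists_rootAt_eq_of_neg hn (isPosRoot_neg_wordProd hn hh hhd hw hw') hv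
  refine ⟨_, _, lab_of_htAfter_eq hn (fun a h1 h2 => (hw' a h1 h2).ge) k, ?_⟩
  rw [← hk]
  exact (isFrame_frame hh hd).rootAt hn (frame_antiperiodic h hd) hhd hw k

theorem isPosRoot_of_eq_rt (hn : 1 ≤ n) {h : ℕ → ℤ} (hh : IsHt n h) {hd : Fin (n + 1)}
    (hhd : fold n hd = n) {a : ℕ} {p : ℤ} (hl : Lab n h a p)
    (h2 : IsPosRoot n (rt (frame h hd) a p) ∨ IsPosRoot n (-rt (frame h hd) a p)) :
    IsPosRoot n (rt (frame h hd) a p) := by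
  refine h2.resolve_right fun h3 => ?_
  obtain ⟨b, q, hb, e⟩ := exists_lab_of_isPosRoot hn hh hhd h3
  exact hl.ne_neg hn hh hb e

theorem isReducedLongest_of_htAfter_eq (hn : 1 ≤ n) {h : ℕ → ℤ} (hh : IsHt n h)
    {hd : Fin (n + 1)} (hhd : fold n hd = n) {w : List (Fin (n + 1))} (hw : Ad h hd w)
    (hw' : ∀ a, 1 ≤ a → a ≤ n → htAfter h w a = h a - (2 * n + 2)) : IsReducedLongest n w := by
  have hr := (isFrame_frame hh hd).rootAt hn (frame_antiperiodic h hd) hhd hw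
  have hl := lab_of_htAfter_eq hn (fun a h1 h2 => (hw' a h1 h2).ge)
  refine isReducedLongest_of_injective hn (isPosRoot_neg_wordProd hn hh hhd hw hw') (fun k => ?_)
    fun k l hkl => ?_
  · have := isPosRoot_or_neg_wordProd hn (Or.inl (isPosRoot_simpleRoot hn (w.get k)))
      (w.take k.val)
    change IsPosRoot n (rootAt n w k) ∨ IsPosRoot n (-rootAt n w k) at this
    rw [hr] at this ⊢
    exact isPosRoot_of_eq_rt hn hh hhd (hl k) this
  · rw [hr, hr] at hkl
    have := (hl k).unique hn hh (hl l) hkl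
    exact lbl_injective h w this.1 this.2

theorem isPosRoot_rt (hn : 1 ≤ n) {h : ℕ → ℤ} (hh : IsHt n h) {hd : Fin (n + 1)}
    (hhd : fold n hd = n) {a : ℕ} {p : ℤ} (hl : Lab n h a p) :
    IsPosRoot n (rt (frame h hd) a p) := by
  obtain ⟨w, hw, hw'⟩ := exists_ad_of_le hn hh (isHt_sub hh (2 * n + 2)) (fun a _ _ => by omega)
    (fun a _ _ => by omega) hhd
  obtain ⟨m, hm⟩ := hl.parity
  have h1 := hl.lower_le
  have h2 := hl.le_ht
  obtain ⟨k, hk, hk'⟩ := exists_lbl_eq h w (a := a) (m := m.toNat) (by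
    rw [hw' a hl.one_le hl.le]; omega)
  have e : rt (frame h hd) a p = rootAt n w k := by
    rw [(isFrame_frame hh hd).rootAt hn (frame_antiperiodic h hd) hhd hw k]
    change _ = rt _ _ (lbl h w k)
    rw [hk, hk']
    congr 1
    omega
  rw [e]
  exact (isReducedLongest_of_htAfter_eq hn hh hhd hw hw').1.isPosRoot_rootAt hn k

/-- The reduced words of the longest element which are adapted to a height function. -/
def Full (h : ℕ → ℤ) (hd : Fin (n + 1)) (w : List (Fin (n + 1))) : Prop :=
  IsReducedLongest n w ∧ Ad h hd w

/-- In a reduced word of `w₀` every orbit occurs exactly `n + 1` times. One more occurrence would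
produce the negative of the first root of the orbit; one fewer would miss the root labelled `h a -
2n`. -/
theorem Full.htAfter_eq (hn : 1 ≤ n) {h : ℕ → ℤ} (hh : IsHt n h)
    {hd : Fin (n + 1)} (hhd : fold n hd = n) {w : List (Fin (n + 1))} (hw : Full h hd w)
    (a : ℕ) (h1 : 1 ≤ a) (h2 : a ≤ n) : htAfter h w a = h a - (2 * n + 2) := by
  have hx := frame_antiperiodic (n := n) h hd
  have hr : ∀ k, rootAt n w k = rt _ _ (lbl h w k) :=
    (isFrame_frame hh hd).rootAt hn hx hhd hw.2
  have hge : ∀ a, 1 ≤ a → a ≤ n → h a - (2 * n + 2) ≤ htAfter h w a := by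
    intro a h1 h2
    by_contra! hlt
    obtain ⟨k, hk, hk'⟩ := exists_lbl_eq h w (a := a) (m := n + 1) (by push_cast; omega)
    have hpos := hw.1.1.isPosRoot_rootAt hn k
    have hp2 := isPosRoot_rt hn hh hhd (a := a) (p := h a) ⟨h1, h2, by omega, le_rfl, by simp⟩
    rw [hr, hk, hk'] at hpos
    have : rt (frame h hd) a (h a) = - rt (frame h hd) a (h a - 2 * (n + 1 : ℕ)) := by
      rw [← rt_add hx]
      congr 1
      push_cast; ring
    rw [this] at hp2
    exact hpos.not_neg hp2
  refine le_antisymm ?_ (hge a h1 h2)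
  have hl : Lab n h a (h a - 2 * n) := ⟨h1, h2, le_rfl, by omega, by omega⟩
  obtain ⟨k, hk⟩ := exists_rootAt_eq_of_neg hn hw.1.2 (isPosRoot_rt hn hh hhd hl)
  rw [hr] at hk
  have hu := (lab_of_htAfter_eq hn hge k).unique hn hh hl hk
  have h3 := htAfter_take_succ h w k
  have h4 := htAfter_le h w (k.val + 1) (fold n (w.get k))
  rw [hu.1] at h3 h4
  omega

theorem full_iff (hn : 1 ≤ n) {h : ℕ → ℤ} (hh : IsHt n h)
    {hd : Fin (n + 1)} (hhd : fold n hd = n) {w : List (Fin (n + 1))} :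
    Full h hd w ↔ Ad h hd w ∧ ∀ a, 1 ≤ a → a ≤ n → htAfter h w a = h a - (2 * n + 2) :=
  ⟨fun hw => ⟨hw.2, hw.htAfter_eq hn hh hhd⟩,
    fun hw => ⟨isReducedLongest_of_htAfter_eq hn hh hhd hw.1 hw.2, hw.1⟩⟩

theorem Full.rootAt_eq (hn : 1 ≤ n) {h : ℕ → ℤ} (hh : IsHt n h)
    {hd : Fin (n + 1)} (hhd : fold n hd = n) {w : List (Fin (n + 1))} (hw : Full h hd w)
    (k : Fin w.length) : Lab n h (fold n (w.get k)) (lbl h w k) ∧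
      rootAt n w k = rt (frame h hd) (fold n (w.get k)) (lbl h w k) :=
  ⟨lab_of_htAfter_eq hn (fun a h1 h2 => (hw.htAfter_eq hn hh hhd a h1 h2).ge) k,
    (isFrame_frame hh hd).rootAt hn (frame_antiperiodic h hd) hhd hw.2 k⟩

theorem Full.rootAt_injective (hn : 1 ≤ n) {h : ℕ → ℤ} (hh : IsHt n h)
    {hd : Fin (n + 1)} (hhd : fold n hd = n) {w : List (Fin (n + 1))} (hw : Full h hd w) :
    Function.Injective (rootAt n w) := by
  intro k l hkl
  have hk := hw.rootAt_eq hn hh hhd k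
  have hl := hw.rootAt_eq hn hh hhd l
  rw [hk.2, hl.2] at hkl
  have := hk.1.unique hn hh hl.1 hkl
  exact lbl_injective h w this.1 this.2

/-- The order attached to a word of the class is a strict linear order on the positive roots. -/
theorem Full.exists_index (hn : 1 ≤ n) {h : ℕ → ℤ} (hh : IsHt n h)
    {hd : Fin (n + 1)} (hhd : fold n hd = n) {w : List (Fin (n + 1))} (hw : Full h hd w) :
    ∃ f : PosRoot n → ℕ, Function.Injective f ∧
      ∀ α β : PosRoot n, Before n w α.val β.val ↔ f α < f β := by
  choose f hf using fun α : PosRoot n => exists_rootAt_eq_of_neg hn hw.1.2 α.2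
  have hinj := hw.rootAt_injective hn hh hhd
  refine ⟨fun α => (f α).val, fun α β e => ?_, fun α β => ⟨?_, fun hlt => ?_⟩⟩
  · exact Subtype.ext (by rw [← hf α, ← hf β, Fin.ext e])
  · rintro ⟨k, l, hkl, e1, e2⟩
    rw [← hf α] at e1
    rw [← hf β] at e2
    dsimp only
    rw [← hinj e1, ← hinj e2]
    exact hkl
  · exact ⟨f α, f β, hlt, hf α, hf β⟩

/-- The order of the twisted Auslander–Reiten quiver is contained in every order of the class. -/
theorem Full.before (hn : 1 ≤ n) {h : ℕ → ℤ} (hh : IsHt n h)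
    {hd : Fin (n + 1)} (hhd : fold n hd = n) {w : List (Fin (n + 1))} (hw : Full h hd w)
    {a b : ℕ} {p q : ℤ} (ha : Lab n h a p) (hb : Lab n h b q) (hne : ¬ (a = b ∧ p = q))
    (h1 : (a : ℤ) - b ≤ p - q) (h2 : (b : ℤ) - a ≤ p - q) :
    Before n w (rt (frame h hd) a p) (rt (frame h hd) b q) := by
  obtain ⟨k, hk⟩ := exists_rootAt_eq_of_neg hn hw.1.2 (isPosRoot_rt hn hh hhd ha)
  obtain ⟨l, hl⟩ := exists_rootAt_eq_of_neg hn hw.1.2 (isPosRoot_rt hn hh hhd hb)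
  refine ⟨k, l, ?_, hk, hl⟩
  have hk' := hw.rootAt_eq hn hh hhd k
  have hl' := hw.rootAt_eq hn hh hhd l
  rw [hk] at hk'
  rw [hl] at hl'
  obtain ⟨k1, k2⟩ := ha.unique hn hh hk'.1 hk'.2
  obtain ⟨l1, l2⟩ := hb.unique hn hh hl'.1 hl'.2
  by_contra hlk
  rcases lt_or_eq_of_le (not_lt.1 hlk) with hlk | hlk
  · by_cases hab : a = b
    · have := lbl_lt h w hlk (by rw [← k1, ← l1, hab])
      omega
    · have hpk := (hw.2.at l).2.2
      have hHt := hh.htAfter hn (hw.2.at l).1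
      have hanti := htAfter_take_anti h w (Fin.lt_def.1 hlk).le a
      have e1 : htAfter h (w.take k.val) a = p := by rw [k2, k1]; rfl
      have e2 : htAfter h (w.take l.val) b = q := by rw [l2, l1]; rfl
      rw [← l1] at hpk
      have a1 := ha.one_le
      have a2 := ha.le
      have b1 := hb.one_le
      have b2 := hb.le
      -- `c` is the neighbour of `b` on the side of `a`. When the letter of `(b, q)` is read first,
      -- `b` is a peak of height `q`, so `c` has height `q - 1`, and the height at `a` is at most `q
      -- + |a - b| - 2`. It cannot reach `p` later.
      obtain ⟨c, hc, c1, c2, hc'⟩ : ∃ c, (c = b + 1 ∨ b = c + 1) ∧ 1 ≤ c ∧ c ≤ n ∧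
          ((b < a ∧ c = b + 1) ∨ (a < b ∧ b = c + 1)) := by
        rcases lt_or_gt_of_ne hab with hlt | hlt
        · exact ⟨b - 1, by omega, by omega, by omega, by omega⟩
        · exact ⟨b + 1, by omega, by omega, by omega, by omega⟩
      have h3 := hpk c c1 c2 hc
      have h4 := hHt.le_add a1 a2 c1 c2
      omega
  · exact hne ⟨by rw [k1, l1, hlk], by rw [k2, l2, hlk]⟩

/-- For every root there is a word of the class in which it comes after its predecessors only. -/
theorem exists_full_of_lab (hn : 1 ≤ n) {h : ℕ → ℤ} (hh : IsHt n h)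
    {hd : Fin (n + 1)} (hhd : fold n hd = n) {b : ℕ} {q : ℤ} (hb : Lab n h b q) :
    ∃ w, Full h hd w ∧ ∀ a p, Lab n h a p →
      Before n w (rt (frame h hd) a p) (rt (frame h hd) b q) →
        (a : ℤ) - b ≤ p - q ∧ (b : ℤ) - a ≤ p - q := by
  -- The labels above `h'` are exactly those with `p ≥ q + |a - b|`, namely `(b, q)` and its
  -- predecessors. The word descends to `h'` first and only then continues to the bottom.
  set h' : ℕ → ℤ := fun a => min (h a) (q + |(a : ℤ) - b| - 2) with hh'
  have b1 := hb.one_le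
  have b2 := hb.le
  have b3 := hb.lower_le
  have b4 := hb.le_ht
  have b5 := hb.parity
  have hpar : ∀ a, 1 ≤ a → a ≤ n → 2 ∣ h a - (q + |(a : ℤ) - b| - 2) := by
    intro a h1 h2
    have p1 := hh.parity h1 h2
    have p2 := hh.parity b1 b2
    rcases abs_cases ((a : ℤ) - b) with h3 | h3 <;> omega
  have hlip : ∀ a, 1 ≤ a → a ≤ n → h a - (2 * n + 2) ≤ q + |(a : ℤ) - b| - 2 := by
    intro a h1 h2
    have := hh.le_add h1 h2 b1 b2
    rcases abs_cases ((a : ℤ) - b) with h3 | h3 <;> omega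
  have hHt : IsHt n h' := by
    intro a h1 h2
    have e1 := hh a h1 h2
    have e2 := hpar a h1 (by omega)
    have e3 := hpar (a + 1) (by omega) h2
    simp only [hh']
    push_cast at *
    rcases abs_cases ((a : ℤ) - b) with h3 | h3 <;>
    rcases abs_cases ((a : ℤ) + 1 - b) with h4 | h4 <;> omega
  obtain ⟨u, hu, hu'⟩ := exists_ad_of_le hn hh hHt (fun a h1 h2 => min_le_left _ _)
    (fun a h1 h2 => by
      have := hpar a h1 h2
      simp only [hh']
      rcases min_cases (h a) (q + |(a : ℤ) - b| - 2) with h3 | h3 <;> rw [h3.1]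
      · simp
      · exact this) hhd
  have hHtu := hh.htAfter hn hu
  have hhdu : fold n (hdAfter hd u) = n := by
    rw [hdAfter_eq hn hhd hu]
    split_ifs
    · exact hhd
    · rw [fold_vee_eq hn, hhd]
  obtain ⟨v, hv, hv'⟩ := exists_ad_of_le hn hHtu (isHt_sub hh (2 * n + 2))
    (fun a h1 h2 => by
      rw [hu' a h1 h2]
      have := hlip a h1 h2
      exact le_min (by omega) this)
    (fun a h1 h2 => by
      simp only [htAfter]
      omega) hhdu
  have hw : Full h hd (u ++ v) := (full_iff hn hh hhd).2
    ⟨ad_append.2 ⟨hu, hv⟩, fun a h1 h2 => by rw [htAfter_append]; exact hv' a h1 h2⟩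
  refine ⟨u ++ v, hw, fun a p ha => ?_⟩
  rintro ⟨k, l, hkl, hk, hl⟩
  have hk' := hw.rootAt_eq hn hh hhd k
  have hl' := hw.rootAt_eq hn hh hhd l
  rw [hk] at hk'
  rw [hl] at hl'
  obtain ⟨k1, k2⟩ := ha.unique hn hh hk'.1 hk'.2
  obtain ⟨l1, l2⟩ := hb.unique hn hh hl'.1 hl'.2
  have eu : (u ++ v).take u.length = u := by simp
  have hlu : l.val < u.length := by
    by_contra! hge
    have h3 := htAfter_take_anti h (u ++ v) hge b
    have e2 : htAfter h ((u ++ v).take l.val) b = q := by rw [l2, l1]; rfl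
    rw [e2, eu, hu' b b1 b2] at h3
    have : h' b ≤ q - 2 := by simp only [hh']; simp
    omega
  have h3 := htAfter_take_anti h (u ++ v) (show k.val + 1 ≤ u.length by
    have := Fin.lt_def.1 hkl; omega) a
  have h4 := htAfter_take_succ h (u ++ v) k
  rw [← k1, ← k2] at h4
  rw [eu, h4, hu' a ha.one_le ha.le] at h3
  have h5 := ha.le_ht
  simp only [hh'] at h3
  rcases abs_cases ((a : ℤ) - b) with h6 | h6 <;> omega

end TwistedD

namespace TwistedD

variable {n : ℕ}

/-! ### Folded coordinates -/

namespace TwistedQuiver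

variable {Q : TwistedQuiver n} {ξ : ℕ → ℤ} {c : List (Fin (n + 1))}

theorem IsCoxeterWord.htAfter_eq (hc : Q.IsCoxeterWord c) {a : ℕ} (h1 : 1 ≤ a) (h2 : a ≤ n) :
    htAfter ξ c a = ξ a - 2 := by
  have : (c.map (fold n)).count a = 1 := by
    rw [hc.1.count_eq]
    exact List.count_eq_one_of_mem List.nodup_range' (by simp [List.mem_range'_1]; omega)
  simp [htAfter, this]

theorem IsCoxeterWord.htAfter_append_eq (hn : 1 ≤ n) (hc : Q.IsCoxeterWord c) {a : ℕ} (h1 : 1 ≤ a)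
    (h2 : a ≤ n) : htAfter ξ (c ++ c.map (vee n)) a = ξ a - 4 := by
  have e : htAfter (htAfter ξ c) (c.map (vee n)) = htAfter (htAfter ξ c) c := by
    funext b
    have : fold n ∘ vee n = fold n := funext fun i => fold_vee_eq hn i
    simp [htAfter, this]
  rw [htAfter_append, e, hc.htAfter_eq h1 h2, hc.htAfter_eq h1 h2]
  ring

theorem IsCoxeterWord.ad_append (hn : 1 ≤ n) (hξ : Q.IsHeight ξ) (hc : Q.IsCoxeterWord c) :
    Ad ξ Q.head (c ++ c.map (vee n)) ∧ hdAfter Q.head (c ++ c.map (vee n)) = Q.head := by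
  have h1 := (hξ.adapted_iff hn c).1 hc.2
  have hcount : (c.map (fold n)).count n = 1 := by
    rw [hc.1.count_eq]
    exact List.count_eq_one_of_mem List.nodup_range' (by simp [List.mem_range'_1]; omega)
  have hhd : hdAfter Q.head c = vee n Q.head := by
    rw [hdAfter_eq hn Q.fold_head h1, hcount, if_neg (by decide)]
  have h2 : Ad (htAfter ξ c) (hdAfter Q.head c) (c.map (vee n)) := by
    rw [hhd]
    exact (h1.map_vee hn).congr (C := -2) (fun a h1 h2 => hc.htAfter_eq h1 h2) hn
  refine ⟨TwistedD.ad_append.2 ⟨h1, h2⟩, ?_⟩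
  have : fold n ∘ vee n = fold n := funext fun i => fold_vee_eq hn i
  rw [hdAfter_append, hdAfter_eq hn (by rw [hhd, fold_vee_eq hn, Q.fold_head]) h2, List.map_map,
    this, hcount, if_neg (by decide), hhd, vee_vee hn]

/-- `c` followed by its image under `∨` visits each orbit twice, so all heights drop by `4` and the
head returns to its start. Hence `ψ` is the shift of the frame by `4`. -/
theorem IsCoxeterWord.wordProd_frame (hn : 1 ≤ n) (hξ : Q.IsHeight ξ) (hc : Q.IsCoxeterWord c)
    {z : ℤ} (hz : 2 ∣ z - (ξ 1 + 1)) :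
    wordProd n (c ++ c.map (vee n)) (frame ξ Q.head z) = frame ξ Q.head (z - 4) := by
  have hx := frame_antiperiodic (n := n) ξ Q.head
  have hA := hc.ad_append hn hξ
  have hW := (isFrame_frame hξ.isHt Q.head).word hn hx Q.fold_head hA.1
  rw [one_mul, hA.2] at hW
  refine pos_induction hn hξ.isHt (P := fun z => wordProd n (c ++ c.map (vee n))
    (frame ξ Q.head z) = frame ξ Q.head (z - 4)) (fun z => ?_) (fun v => ?_) hz
  · rw [hx, add_sub_right_comm, hx, map_neg, neg_inj]
  · rw [frame_pos hξ.isHt, map_smul, hW, smul_smul, sgn_mul_self, one_smul,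
      pos_congr (h := ξ) (C := -4) hn
        (fun a h1 h2 => hc.htAfter_append_eq hn h1 h2) (by omega), sub_eq_add_neg]

/-- Folded coordinates are the labels of the frame. This is all that is used about the labelling
algorithm. -/
theorem IsCoxeterWord.lab_of_twistedCoord (hn : 1 ≤ n) (hξ : Q.IsHeight ξ)
    (hc : Q.IsCoxeterWord c) {v : Lat n} {i : Fin (n + 1)} {p : ℤ}
    (h : TwistedCoord c ξ v i p) :
    Lab n ξ (fold n i) p ∧ v = rt (frame ξ Q.head) (fold n i) p := by
  have hx := frame_antiperiodic (n := n) ξ Q.head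
  have hA := (hc.ad_append hn hξ).1
  have hc1 := (hξ.adapted_iff hn c).1 hc.2
  have hF := isFrame_frame hξ.isHt Q.head
  induction h with
  | first k =>
    have f1 := one_le_fold hn (c.get k)
    have f2 := fold_le (c.get k)
    refine ⟨⟨f1, f2, by omega, le_rfl, by simp⟩, ?_⟩
    have e1 := htAfter_take_succ ξ c k
    have e2 := htAfter_le ξ c (k.val + 1) (fold n (c.get k))
    have e3 : lbl ξ c k ≤ ξ (fold n (c.get k)) := by unfold lbl htAfter; omega
    rw [hc.htAfter_eq f1 f2, e1] at e2
    rw [hF.rootAt hn hx Q.fold_head hc1 k]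
    congr 1
    have e4 : ξ (fold n (c.get k)) ≤ lbl ξ c k := by omega
    exact le_antisymm e3 e4
  | second k =>
    rw [fold_vee_eq hn]
    have f1 := one_le_fold hn (c.get k)
    have f2 := fold_le (c.get k)
    refine ⟨⟨f1, f2, by omega, by omega, by omega⟩, ?_⟩
    set w := c ++ c.map (vee n) with hw
    let K : Fin w.length := ⟨c.length + k.val, by rw [hw]; simp⟩
    have eK : w.get K = vee n (c.get k) := by
      simp [hw, K]
    have tK : w.take K.val = c ++ (c.take k.val).map (vee n) := by
      simp only [hw, K, List.take_length_add_append, List.map_take]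
    have e1 := htAfter_take_succ ξ w K
    have e2 := htAfter_le ξ w (K.val + 1) (fold n (w.get K))
    have e3 : lbl ξ w K ≤ ξ (fold n (c.get k)) - 2 := by
      rw [← hc.htAfter_eq f1 f2]
      unfold lbl
      rw [tK, eK, fold_vee_eq hn, htAfter_append]
      rw [htAfter]
      omega
    have e4 := hF.rootAt hn hx Q.fold_head hA K
    change _ = rt _ _ (lbl ξ w K) at e4
    rw [rootAt, tK, eK, fold_vee_eq hn] at e4
    rw [e1, eK, fold_vee_eq hn, hc.htAfter_append_eq hn f1 f2] at e2
    rw [e4]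
    congr 1
    omega
  | step β i p hβ hψ h ih =>
    obtain ⟨hl, e⟩ := ih
    have hd := hl.dvd hξ.isHt
    have e2 : wordProd n (c ++ c.map (vee n)) β = rt (frame ξ Q.head) (fold n i) (p - 4) := by
      rw [e, rt, map_sub, hc.wordProd_frame hn hξ hd.1, hc.wordProd_frame hn hξ hd.2, rt]
      congr 2 <;> ring
    refine ⟨⟨hl.one_le, hl.le, ?_, ?_, ?_⟩, e2⟩
    -- Below the range of labels, a shift by `2n+2` leads back into it, so `ψ β` would be the
    -- negative of a positive root.
    · by_contra! hlt
      have h1 := hl.lower_le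
      have h2 := hl.parity
      have hl2 : Lab n ξ (fold n i) (p - 4 + (2 * n + 2)) :=
        ⟨hl.one_le, hl.le, by omega, by omega, by omega⟩
      have h3 := isPosRoot_rt hn hξ.isHt Q.fold_head hl2
      rw [rt_add hx, ← e2] at h3
      exact hψ.not_neg h3
    · have := hl.le_ht; omega
    · have := hl.parity; omega

theorem IsCoxeterWord.lab_of_foldedCoord (hn : 1 ≤ n) (hξ : Q.IsHeight ξ)
    (hc : Q.IsCoxeterWord c) {β : PosRoot n} {a : ℕ} {p : ℤ} (h : FoldedCoord c ξ β a p) :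
    Lab n ξ a p ∧ β.val = rt (frame ξ Q.head) a p := by
  obtain ⟨i, hi, rfl⟩ := h
  exact hc.lab_of_twistedCoord hn hξ hi

end TwistedQuiver

end TwistedD

namespace TwistedD

variable {n : ℕ}

/-! ### Sequences between a root and a pair -/

theorem weight_single (γ : PosRoot n) : weight (Finsupp.single γ 1) = γ.val := by
  simp [weight]

theorem weight_add (m m' : PosRoot n →₀ ℕ) : weight (m + m') = weight m + weight m' := by
  unfold weight
  exact Finsupp.sum_add_index' (fun _ => zero_smul ℕ _) fun _ _ _ => add_smul _ _ _

theorem PosRoot.ne_zero (γ : PosRoot n) : γ.val ≠ 0 := fun e => by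
  have := γ.2.dotProduct_self
  rw [e] at this
  simp at this

theorem eq_zero_of_weight_eq_zero {m : PosRoot n →₀ ℕ} (h : weight m = 0) : m = 0 := by
  by_contra hm
  have h1 : rhoPairing n (weight m) = 0 := by rw [h, map_zero]
  have h2 : 0 < rhoPairing n (weight m) := by
    unfold weight Finsupp.sum
    rw [map_sum]
    refine Finset.sum_pos (fun δ hδ => ?_) (Finsupp.support_nonempty_iff.2 hm)
    rw [map_nsmul]
    exact nsmul_pos δ.2.rhoPairing_pos (Finsupp.mem_support_iff.1 hδ)
  omega

/-- Once `γ` is removed the rest has weight zero, and a nonempty sum of positive roots has positive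
pairing with `rhoPairing`. -/
theorem eq_single_of_weight_eq {m : PosRoot n →₀ ℕ} {γ : PosRoot n} (h : weight m = γ.val)
    (hγ : m γ ≠ 0) : m = Finsupp.single γ 1 := by
  have e : m = (m - Finsupp.single γ 1) + Finsupp.single γ 1 :=
    (tsub_add_cancel_of_le (Finsupp.single_le_iff.2 (by omega))).symm
  rw [e, weight_add, weight_single] at h
  rw [e, eq_zero_of_weight_eq_zero (add_eq_right.1 h), zero_add]

theorem biLex_irrefl {w : List (Fin (n + 1))} (m : PosRoot n →₀ ℕ) : ¬ BiLex n w m m :=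
  fun h => by
    obtain ⟨β, hβ, -⟩ := h.1
    exact lt_irrefl _ hβ

theorem biLex_pair {w : List (Fin (n + 1))} {f : PosRoot n → ℕ}
    (hw : ∀ α β : PosRoot n, Before n w α.val β.val ↔ f α < f β) {α β : PosRoot n}
    (hαβ : f α < f β) {m : PosRoot n →₀ ℕ} (hm : ∀ δ, m δ ≠ 0 → f α < f δ ∧ f δ < f β) :
    BiLex n w m (Finsupp.single α 1 + Finsupp.single β 1) := by
  have hα : m α = 0 := by by_contra h; exact lt_irrefl _ (hm α h).1
  have hβ : m β = 0 := by by_contra h; exact lt_irrefl _ (hm β h).2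
  refine ⟨⟨α, by simp [hα], fun δ hδ => ?_⟩, ⟨β, by simp [hβ], fun δ hδ => ?_⟩⟩
  · rw [hw] at hδ
    have h1 : δ ≠ α := by rintro rfl; omega
    have h2 : δ ≠ β := by rintro rfl; omega
    have h3 : m δ = 0 := by by_contra h; have := hm δ h; omega
    simp [h1, h2, h3]
  · rw [hw] at hδ
    have h1 : δ ≠ α := by rintro rfl; omega
    have h2 : δ ≠ β := by rintro rfl; omega
    have h3 : m δ = 0 := by by_contra h; have := hm δ h; omega
    simp [h1, h2, h3]

/-- The first and last differences occur where the pair has the larger entry, hence at `α` or `β`.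
If both occurred at the same root, `m` would be the other root alone, of the wrong weight. So they
are at `α` and at `β`, and `m` vanishes there and outside. -/
theorem lt_and_lt_of_biLex_pair {w : List (Fin (n + 1))} {f : PosRoot n → ℕ}
    (hf : Function.Injective f)
    (hw : ∀ α β : PosRoot n, Before n w α.val β.val ↔ f α < f β) {α β : PosRoot n}
    (hαβ : f α < f β) {m : PosRoot n →₀ ℕ} (hwt : weight m = α.val + β.val)
    (h : BiLex n w m (Finsupp.single α 1 + Finsupp.single β 1)) :
    ∀ δ, m δ ≠ 0 → f α < f δ ∧ f δ < f β := by
  have hne : α ≠ β := by rintro rfl; omega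
  have hval : ∀ δ, δ ≠ α → δ ≠ β → (Finsupp.single α 1 + Finsupp.single β 1 : PosRoot n →₀ ℕ) δ = 0 :=
    fun δ h1 h2 => by simp [h1, h2]
  have hvα : (Finsupp.single α 1 + Finsupp.single β 1 : PosRoot n →₀ ℕ) α = 1 := by simp [hne]
  have hvβ : (Finsupp.single α 1 + Finsupp.single β 1 : PosRoot n →₀ ℕ) β = 1 := by
    simp [hne.symm]
  obtain ⟨⟨δ₁, h1, h1'⟩, ⟨δ₂, h2, h2'⟩⟩ := h
  simp only [hw] at h1' h2'
  have hmem : ∀ δ, m δ < (Finsupp.single α 1 + Finsupp.single β 1 : PosRoot n →₀ ℕ) δ →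
      m δ = 0 ∧ (δ = α ∨ δ = β) := by
    intro δ hδ
    by_cases e1 : δ = α
    · subst e1; rw [hvα] at hδ; exact ⟨by omega, Or.inl rfl⟩
    by_cases e2 : δ = β
    · subst e2; rw [hvβ] at hδ; exact ⟨by omega, Or.inr rfl⟩
    · rw [hval δ e1 e2] at hδ; omega
  have hα1 : δ₁ = α := by
    rcases hmem δ₁ h1 with ⟨h0, rfl | rfl⟩
    · rfl
    exfalso
    have hα : m α = 1 := by rw [h1' α hαβ, hvα]
    rcases hmem δ₂ h2 with ⟨h0', rfl | rfl⟩
    · omega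
    · have : m = Finsupp.single α 1 := by
        ext δ
        rcases lt_trichotomy (f δ) (f δ₂) with hlt | heq | hgt
        · rw [h1' δ hlt]
          have : δ ≠ δ₂ := by rintro rfl; omega
          simp [this]
        · rw [hf heq, h0]; simp [hne.symm]
        · rw [h2' δ hgt]
          have : δ ≠ δ₂ := by rintro rfl; omega
          simp [this]
      rw [this, weight_single] at hwt
      exact δ₂.ne_zero (left_eq_add.1 hwt)
  subst hα1
  have h0 := (hmem δ₁ h1).1
  have hβ2 : δ₂ = β := by
    rcases hmem δ₂ h2 with ⟨h0', rfl | rfl⟩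
    · exfalso
      have : m = Finsupp.single β 1 := by
        ext δ
        rcases lt_trichotomy (f δ) (f δ₂) with hlt | heq | hgt
        · rw [h1' δ hlt]
          have : δ ≠ δ₂ := by rintro rfl; omega
          simp [this]
        · rw [hf heq, h0]; simp [hne]
        · rw [h2' δ hgt]
          have : δ ≠ δ₂ := by rintro rfl; omega
          simp [this]
      rw [this, weight_single] at hwt
      exact δ₂.ne_zero (right_eq_add.1 hwt)
    · rfl
  subst hβ2
  have h0' := (hmem δ₂ h2).1
  intro δ hδ
  have e1 : δ ≠ δ₁ := fun e => hδ (e ▸ h0)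
  have e2 : δ ≠ δ₂ := fun e => hδ (e ▸ h0')
  have e1' : f δ ≠ f δ₁ := fun e => e1 (hf e)
  have e2' : f δ ≠ f δ₂ := fun e => e2 (hf e)
  constructor
  · by_contra hlt
    exact hδ (by rw [h1' δ (by omega), hval δ e1 e2])
  · by_contra hlt
    exact hδ (by rw [h2' δ (by omega), hval δ e1 e2])

/-! ### Sums of intervals -/

section Intervals

variable {ι : Type*} {S : Finset ι} {m : ι → ℕ}

theorem exists_pos_of_sum_eq_one {c : ι → ℤ} (h : ∑ δ ∈ S, (m δ : ℤ) * c δ = 1) :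
    ∃ δ ∈ S, 0 < c δ := by
  by_contra! hc
  have : ∑ δ ∈ S, (m δ : ℤ) * c δ ≤ 0 :=
    Finset.sum_nonpos fun δ hδ => mul_nonpos_of_nonneg_of_nonpos (by omega) (hc δ hδ)
  omega

theorem eq_of_sum_eq_one (hm : ∀ δ ∈ S, m δ ≠ 0) {c : ι → ℤ} (hc : ∀ δ ∈ S, 0 ≤ c δ)
    (h : ∑ δ ∈ S, (m δ : ℤ) * c δ = 1) {δ δ' : ι} (hδ : δ ∈ S) (hδ' : δ' ∈ S) (h1 : 0 < c δ)
    (h2 : 0 < c δ') : δ = δ' := by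
  classical
  by_contra hne
  have hp : ∀ ε ∈ S, 0 < c ε → 1 ≤ (m ε : ℤ) * c ε := fun ε hε h0 => by
    have : 0 < (m ε : ℤ) := by have := hm ε hε; omega
    exact mul_pos this h0
  have h3 := Finset.sum_le_sum_of_subset_of_nonneg
    (show {δ, δ'} ⊆ S by simp [Finset.insert_subset_iff, hδ, hδ'])
    (f := fun ε => (m ε : ℤ) * c ε) fun ε hε _ => mul_nonneg (by omega) (hc ε hε)
  rw [Finset.sum_pair hne, h] at h3
  have := hp δ hδ h1
  have := hp δ' hδ' h2
  omega

theorem nonpos_of_sum_eq_zero (hm : ∀ δ ∈ S, m δ ≠ 0) {c : ι → ℤ} (hc : ∀ δ ∈ S, 0 ≤ c δ)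
    (h : ∑ δ ∈ S, (m δ : ℤ) * c δ = 0) {δ : ι} (hδ : δ ∈ S) : c δ = 0 := by
  have := (Finset.sum_eq_zero_iff_of_nonneg
    (fun ε hε => mul_nonneg (Int.natCast_nonneg (m ε)) (hc ε hε))).1 h δ hδ
  rcases mul_eq_zero.1 this with h1 | h1
  · exact absurd (by exact_mod_cast h1) (hm δ hδ)
  · exact h1

variable {L a b μ : ℤ} {s t : ι → ℤ}

/-- The interval `[a, b]`, of length less than the antiperiod, is not a sum of other intervals
between `[μ, b]` and `[a, μ]`. -/
theorem exists_interval_of_mid (hm : ∀ δ ∈ S, m δ ≠ 0)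
    (hS : ∀ f : ℤ → ℤ, Function.Antiperiodic f L →
      ∑ δ ∈ S, (m δ : ℤ) * (f (t δ) - f (s δ)) = f b - f a)
    (h1 : a < μ) (h2 : μ < b) (h3 : b < a + L)
    (hs : ∀ δ ∈ S, a ≤ s δ ∧ s δ ≤ μ ∧ μ ≤ t δ ∧ t δ ≤ b)
    (hα : ∀ δ ∈ S, ¬ (s δ = μ ∧ t δ = b)) (hβ : ∀ δ ∈ S, ¬ (s δ = a ∧ t δ = μ)) :
    ∃ δ ∈ S, s δ = a ∧ t δ = b := by
  -- All endpoints lie in `[a, a + L)`, so antiperiodicity is no constraint and any test function is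
  -- allowed.
  have key : ∀ g : ℤ → ℤ, ∑ δ ∈ S, (m δ : ℤ) * (g (t δ) - g (s δ)) = g b - g a := by
    intro g
    have := hS (anti L a g) (anti_antiperiodic (by omega) _ _)
    rw [anti_of_mem g (by omega) (by omega), anti_of_mem g (by omega) (by omega)] at this
    rw [← this]
    refine Finset.sum_congr rfl fun δ hδ => ?_
    have := hs δ hδ
    rw [anti_of_mem g (by omega) (by omega), anti_of_mem g (by omega) (by omega)]
  have k1 := key fun z => if z = b then 1 else 0
  rw [if_pos rfl, if_neg (by omega)] at k1
  have k2 := key fun z => if z = a then -1 else 0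
  rw [if_pos rfl, if_neg (by omega)] at k2
  -- This counts the intervals that end beyond `μ`: there is one, with multiplicity. The interval
  -- ending at `b` and the one starting at `a` both do, so they are equal.
  have k3 := key fun z => if μ < z then 1 else 0
  rw [if_pos h2, if_neg (by omega)] at k3
  obtain ⟨δ₁, m1, e1⟩ := exists_pos_of_sum_eq_one k1
  obtain ⟨δ₂, m2, e2⟩ := exists_pos_of_sum_eq_one k2
  have q1 := hs _ m1
  have q2 := hs _ m2
  have a1 := hα _ m1
  have b2 := hβ _ m2
  have t1 : t δ₁ = b := by split_ifs at e1 <;> omega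
  have s2 : s δ₂ = a := by split_ifs at e2 <;> omega
  have : δ₁ = δ₂ := by
    refine eq_of_sum_eq_one hm (fun δ hδ => ?_) k3 m1 m2 ?_ ?_
    · have := hs δ hδ
      split_ifs <;> omega
    · split_ifs <;> omega
    · split_ifs <;> omega
  exact ⟨δ₁, m1, this ▸ s2, t1⟩

/-- The interval `[a, b]` is not a sum of other intervals between `[a, μ + L]` and
`[b - L, μ]`. -/
theorem exists_interval_of_left (hm : ∀ δ ∈ S, m δ ≠ 0)
    (hS : ∀ f : ℤ → ℤ, Function.Antiperiodic f L →
      ∑ δ ∈ S, (m δ : ℤ) * (f (t δ) - f (s δ)) = f b - f a)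
    (h1 : b - L < μ) (h2 : μ < a) (h3 : a < b)
    (hs : ∀ δ ∈ S, b - L ≤ s δ ∧ s δ ≤ a ∧ μ ≤ t δ ∧ t δ ≤ μ + L ∧ s δ < t δ)
    (hα : ∀ δ ∈ S, ¬ (s δ = a ∧ t δ = μ + L)) :
    ∃ δ ∈ S, s δ = a ∧ t δ = b := by
  -- Endpoints are folded into `[μ, μ + L)`: a left end below `μ` is moved up by `L`, a right end at
  -- `μ + L` down to `μ`, each with a change of sign.
  have key : ∀ g : ℤ → ℤ, ∑ δ ∈ S, (m δ : ℤ) * ((if t δ < μ + L then g (t δ) else -g μ) -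
      (if μ ≤ s δ then g (s δ) else -g (s δ + L))) = g b - g a := by
    intro g
    have := hS (anti L μ g) (anti_antiperiodic (by omega) _ _)
    rw [anti_of_mem g (by omega) (by omega), anti_of_mem g (by omega) (by omega)] at this
    rw [← this]
    refine Finset.sum_congr rfl fun δ hδ => ?_
    have := hs δ hδ
    congr 2
    · split_ifs with h
      · rw [anti_of_mem g (by omega) (by omega)]
      · rw [anti_of_ge g (by omega) (by omega)]
        congr 2; omega
    · split_ifs with h
      · rw [anti_of_mem g h (by omega)]
      · rw [anti_of_lt g (by omega) (by omega)]
  have k1 := key fun z => if z = b then 1 else 0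
  rw [if_pos rfl, if_neg (by omega), if_neg (by omega)] at k1
  have k2 := key fun z => if z = a then -1 else 0
  rw [if_pos rfl, if_neg (by omega), if_neg (by omega)] at k2
  -- After folding, this counts endpoints in `[b, μ + L)`, all of them with sign `+`. The next
  -- identity shows that no interval ends strictly between `a` and `b`, so the one starting at `a`
  -- is counted here too and must be the one that contributes `b`.
  have k3 := key fun z => if b ≤ z then 1 else 0
  rw [if_pos le_rfl, if_neg (by omega), if_neg (by omega)] at k3
  have k4 := key fun z => if a < z ∧ z < b then 1 else 0
  rw [if_neg (by omega), if_neg (by omega), if_neg (by omega)] at k4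
  obtain ⟨δ₁, m1, e1⟩ := exists_pos_of_sum_eq_one k1
  obtain ⟨δ₂, m2, e2⟩ := exists_pos_of_sum_eq_one k2
  have q1 := hs _ m1
  have q2 := hs _ m2
  have a2 := hα _ m2
  have n2 := nonpos_of_sum_eq_zero hm (fun δ hδ => by
    have := hs δ hδ
    split_ifs <;> omega) k4 m2
  have t1 : t δ₁ = b ∨ s δ₁ = b - L := by split_ifs at e1 <;> omega
  have s2 : s δ₂ = a := by split_ifs at e2 <;> omega
  have t2 : b ≤ t δ₂ ∧ t δ₂ < μ + L := by split_ifs at n2 <;> omega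
  have : δ₁ = δ₂ := by
    refine eq_of_sum_eq_one hm (fun δ hδ => ?_) k3 m1 m2 ?_ ?_
    · have := hs δ hδ
      split_ifs <;> omega
    · split_ifs <;> omega
    · split_ifs <;> omega
  subst this
  exact ⟨δ₁, m1, s2, by omega⟩

/-- The interval `[a, b]` is not a sum of other intervals between `[μ, a + L]` and
`[μ - L, b]`. -/
theorem exists_interval_of_right (hm : ∀ δ ∈ S, m δ ≠ 0)
    (hS : ∀ f : ℤ → ℤ, Function.Antiperiodic f L →
      ∑ δ ∈ S, (m δ : ℤ) * (f (t δ) - f (s δ)) = f b - f a)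
    (h1 : μ - L < a) (h2 : a < b) (h3 : b < μ)
    (hs : ∀ δ ∈ S, μ - L ≤ s δ ∧ s δ ≤ μ ∧ b ≤ t δ ∧ t δ ≤ a + L ∧ s δ < t δ)
    (hα : ∀ δ ∈ S, ¬ (s δ = μ - L ∧ t δ = b)) :
    ∃ δ ∈ S, s δ = a ∧ t δ = b := by
  -- The reflection `z ↦ -z` exchanges left and right ends and reduces to the previous case.
  have hS' : ∀ f : ℤ → ℤ, Function.Antiperiodic f L →
      ∑ δ ∈ S, (m δ : ℤ) * (f (-s δ) - f (-t δ)) = f (-a) - f (-b) := by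
    intro f hf
    have := hS (fun z => -f (-z)) fun z => by
      dsimp only
      rw [neg_add, ← sub_eq_add_neg, hf.sub_eq]
    rw [show f (-a) - f (-b) = -f (-b) - -f (-a) by ring, ← this]
    exact Finset.sum_congr rfl fun δ _ => by ring
  obtain ⟨δ, hδ, e⟩ := exists_interval_of_left (s := fun δ => -t δ) (t := fun δ => -s δ) (μ := -μ)
    hm hS' (by omega) (by omega) (by omega)
    (fun δ hδ => by have := hs δ hδ; omega) (fun δ hδ => by have := hα δ hδ; omega)
  exact ⟨δ, hδ, by omega, by omega⟩

end Intervals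

end TwistedD

namespace TwistedD

variable {n : ℕ}

/-! ### Minimal pairs in terms of labels. -/

/-- The labels are convex for the order because height functions are `1`-Lipschitz. This shows that
the candidates for `γ` and for intermediate pairs are roots. -/
theorem Lab.of_between {h : ℕ → ℤ} (hh : IsHt n h) {a b c : ℕ} {p q u : ℤ} (ha : Lab n h a p)
    (hb : Lab n h b q) (c1 : 1 ≤ c) (c2 : c ≤ n) (h1 : (a : ℤ) - c ≤ p - u)
    (h2 : (c : ℤ) - a ≤ p - u) (h3 : (c : ℤ) - b ≤ u - q) (h4 : (b : ℤ) - c ≤ u - q)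
    (hpar : 2 ∣ p + a - (u + c)) : Lab n h c u := by
  have e1 := hh.le_add ha.one_le ha.le c1 c2
  have e2 := hh.le_add c1 c2 hb.one_le hb.le
  have e3 := hh.parity c1 c2
  have e4 := hh.parity ha.one_le ha.le
  obtain ⟨a1, a2, a3, a4, a5⟩ := ha
  obtain ⟨b1, b2, b3, b4, b5⟩ := hb
  exact ⟨c1, c2, by omega, by omega, by omega⟩

namespace TwistedQuiver

variable {Q : TwistedQuiver n} {ξ : ℕ → ℤ}

theorem mem_cls_iff (hn : 1 ≤ n) (hξ : Q.IsHeight ξ) (w : List (Fin (n + 1))) :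
    w ∈ Q.cls ↔ Full ξ Q.head w := by
  simp only [cls, Set.mem_ofPred_eq, Full, hξ.adapted_iff hn]

theorem cls_nonempty (hn : 1 ≤ n) (hξ : Q.IsHeight ξ) : Q.cls.Nonempty := by
  obtain ⟨w, hw, -⟩ := exists_full_of_lab hn hξ.isHt Q.fold_head
    (b := 1) (q := ξ 1) ⟨le_rfl, hn, by omega, le_rfl, by simp⟩
  exact ⟨w, (mem_cls_iff hn hξ w).2 hw⟩

theorem exists_index (hn : 1 ≤ n) (hξ : Q.IsHeight ξ) {w : List (Fin (n + 1))} (hw : w ∈ Q.cls) :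
    ∃ f : PosRoot n → ℕ, Function.Injective f ∧
      ∀ α β : PosRoot n, Before n w α.val β.val ↔ f α < f β :=
  ((mem_cls_iff hn hξ w).1 hw).exists_index hn hξ.isHt Q.fold_head

theorem Prec.trans (hn : 1 ≤ n) (hξ : Q.IsHeight ξ) {α β γ : PosRoot n}
    (h1 : Q.Prec α.val β.val) (h2 : Q.Prec β.val γ.val) : Q.Prec α.val γ.val := by
  intro w hw
  obtain ⟨f, -, hf⟩ := exists_index hn hξ hw
  have := h1 w hw
  have := h2 w hw
  rw [hf] at *
  omega

/-- The two inequalities compare right ends and left ends of the intervals. Necessity is tested on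
the single word from `exists_full_of_lab`. -/
theorem prec_iff (hn : 1 ≤ n) (hξ : Q.IsHeight ξ) {α β : PosRoot n} {a b : ℕ} {p q : ℤ}
    (ha : Lab n ξ a p) (hb : Lab n ξ b q) (hα : α.val = rt (frame ξ Q.head) a p)
    (hβ : β.val = rt (frame ξ Q.head) b q) :
    Q.Prec α.val β.val ↔ ¬ (a = b ∧ p = q) ∧ (a : ℤ) - b ≤ p - q ∧ (b : ℤ) - a ≤ p - q := by
  refine ⟨fun h => ?_, fun h w hw => ?_⟩
  · obtain ⟨w, hw, hw'⟩ := exists_full_of_lab hn hξ.isHt Q.fold_head hb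
    have hwc := (mem_cls_iff hn hξ w).2 hw
    have hB := h w hwc
    refine ⟨?_, hw' a p ha (by rwa [← hα, ← hβ])⟩
    rintro ⟨rfl, rfl⟩
    obtain ⟨f, -, hf⟩ := exists_index hn hξ hwc
    rw [hf, Subtype.ext (hα.trans hβ.symm)] at hB
    exact lt_irrefl _ hB
  · rw [hα, hβ]
    exact ((mem_cls_iff hn hξ w).1 hw).before hn hξ.isHt Q.fold_head ha hb h.1 h.2.1 h.2.2

theorem seqPrec_pair (hn : 1 ≤ n) (hξ : Q.IsHeight ξ) {α β : PosRoot n}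
    (hαβ : Q.Prec α.val β.val) {m : PosRoot n →₀ ℕ} (hwt : weight m = α.val + β.val)
    (hm : ∀ δ, m δ ≠ 0 → Q.Prec α.val δ.val ∧ Q.Prec δ.val β.val) :
    Q.SeqPrec m (Finsupp.single α 1 + Finsupp.single β 1) := by
  refine ⟨by rw [hwt, weight_add, weight_single, weight_single], fun w hw => ?_⟩
  obtain ⟨f, -, hf⟩ := exists_index hn hξ hw
  exact biLex_pair hf ((hf _ _).1 (hαβ w hw)) fun δ hδ =>
    ⟨(hf _ _).1 ((hm δ hδ).1 w hw), (hf _ _).1 ((hm δ hδ).2 w hw)⟩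

theorem SeqPrec.prec_and_prec (hn : 1 ≤ n) (hξ : Q.IsHeight ξ) {α β : PosRoot n}
    (hαβ : Q.Prec α.val β.val) {m : PosRoot n →₀ ℕ}
    (h : Q.SeqPrec m (Finsupp.single α 1 + Finsupp.single β 1)) (δ : PosRoot n) (hδ : m δ ≠ 0) :
    Q.Prec α.val δ.val ∧ Q.Prec δ.val β.val := by
  have hwt := h.1
  rw [weight_add, weight_single, weight_single] at hwt
  have key : ∀ w ∈ Q.cls, Before n w α.val δ.val ∧ Before n w δ.val β.val := by
    intro w hw
    obtain ⟨f, hinj, hf⟩ := exists_index hn hξ hw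
    rw [hf, hf]
    exact lt_and_lt_of_biLex_pair hinj hf ((hf _ _).1 (hαβ w hw)) hwt (h.2 w hw) δ hδ
  exact ⟨fun w hw => (key w hw).1, fun w hw => (key w hw).2⟩

theorem seqPrec_single_pair (hn : 1 ≤ n) (hξ : Q.IsHeight ξ) {α β γ : PosRoot n}
    (hsum : α.val + β.val = γ.val) (h1 : Q.Prec α.val γ.val) (h2 : Q.Prec γ.val β.val) :
    Q.SeqPrec (Finsupp.single γ 1) (Finsupp.single α 1 + Finsupp.single β 1) := by
  refine seqPrec_pair hn hξ (h1.trans hn hξ h2) (by rw [weight_single, hsum]) fun δ hδ => ?_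
  have : δ = γ := by
    by_contra hne
    exact hδ (Finsupp.single_eq_of_ne hne)
  subst this
  exact ⟨h1, h2⟩

theorem isMinimalPair_of_forall (hn : 1 ≤ n) (hξ : Q.IsHeight ξ) {α β γ : PosRoot n}
    (hsum : α.val + β.val = γ.val) (h1 : Q.Prec α.val γ.val) (h2 : Q.Prec γ.val β.val)
    (h : ∀ m : PosRoot n →₀ ℕ, weight m = γ.val →
      (∀ δ, m δ ≠ 0 → Q.Prec α.val δ.val ∧ Q.Prec δ.val β.val) → m γ ≠ 0) :
    Q.IsMinimalPair α β γ := by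
  have hαβ := h1.trans hn hξ h2
  refine ⟨hαβ, seqPrec_single_pair hn hξ hsum h1 h2, ?_⟩
  rintro ⟨m, hm1, hm2⟩
  have hwt : weight m = γ.val := by rw [← hm1.1, weight_single]
  have := eq_single_of_weight_eq hwt (h m hwt (hm2.prec_and_prec hn hξ hαβ))
  -- A word is needed here: over an empty class the order on sequences would be vacuous and not
  -- irreflexive.
  obtain ⟨w, hw⟩ := cls_nonempty hn hξ
  have h3 := hm1.2 w hw
  rw [this] at h3
  exact biLex_irrefl _ h3

theorem IsMinimalPair.false_of_between (hn : 1 ≤ n) (hξ : Q.IsHeight ξ) {α β γ α' β' : PosRoot n}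
    (hmin : Q.IsMinimalPair α β γ) (hsum : α.val + β.val = γ.val)
    (hsum' : α'.val + β'.val = γ.val) (h1 : Q.Prec α.val α'.val) (h2 : Q.Prec α'.val γ.val)
    (h3 : Q.Prec γ.val β'.val) (h4 : Q.Prec β'.val β.val) : False := by
  refine hmin.2.2 ⟨Finsupp.single α' 1 + Finsupp.single β' 1,
    seqPrec_single_pair hn hξ hsum' h2 h3,
    seqPrec_pair hn hξ hmin.1 (by rw [weight_add, weight_single, weight_single, hsum, hsum'])
      fun δ hδ => ?_⟩
  have hαβ := h2.trans hn hξ h3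
  by_cases e1 : δ = α'
  · subst e1
    exact ⟨h1, hαβ.trans hn hξ h4⟩
  by_cases e2 : δ = β'
  · subst e2
    exact ⟨h1.trans hn hξ hαβ, h4⟩
  · simp [e1, e2] at hδ

/-- A sequence of weight `γ` gives an identity for antiperiodic functions. -/
theorem sum_eq_of_weight_eq (hn : 1 ≤ n) (hξ : Q.IsHeight ξ) {γ : PosRoot n} {k : ℕ} {r : ℤ}
    (hk : Lab n ξ k r) (hγ : γ.val = rt (frame ξ Q.head) k r) {A : PosRoot n → ℕ}
    {P : PosRoot n → ℤ} (hA : ∀ δ, Lab n ξ (A δ) (P δ))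
    (hP : ∀ δ : PosRoot n, δ.val = rt (frame ξ Q.head) (A δ) (P δ)) {m : PosRoot n →₀ ℕ}
    (hm : weight m = γ.val) {f : ℤ → ℤ} (hf : Function.Antiperiodic f (2 * n + 2 : ℤ)) :
    ∑ δ ∈ m.support, (m δ : ℤ) * (f (P δ + A δ) - f (P δ - A δ)) = f (r + k) - f (r - k) := by
  obtain ⟨F, hF⟩ := exists_functional hn hξ.isHt Q.head hf
  have hrt : ∀ {a p}, Lab n ξ a p → F (rt (frame ξ Q.head) a p) = f (p + a) - f (p - a) := by
    intro a p h
    have := h.dvd hξ.isHt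
    rw [rt, map_sub, hF _ this.1, hF _ this.2]
  rw [← hrt hk, ← hγ, ← hm, weight, Finsupp.sum, map_sum]
  refine Finset.sum_congr rfl fun δ _ => ?_
  rw [map_nsmul, hP δ, hrt (hA δ), nsmul_eq_mul]

variable {α β γ : PosRoot n} {i j k : ℕ} {p q r : ℤ}

theorem isMinimalPair_of_lab (hn : 1 ≤ n) (hξ : Q.IsHeight ξ)
    (hi : Lab n ξ i p) (hj : Lab n ξ j q) (hk : Lab n ξ k r)
    (hα : α.val = rt (frame ξ Q.head) i p) (hβ : β.val = rt (frame ξ Q.head) j q)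
    (hγ : γ.val = rt (frame ξ Q.head) k r) (hsum : α.val + β.val = γ.val)
    (h : (i + j = k ∧ q - r = -(i : ℤ) ∧ p - r = (j : ℤ)) ∨
      (j + k = i ∧ q - r = (i : ℤ) - (2 * n + 2) ∧ p - r = (j : ℤ)) ∨
      (i + k = j ∧ q - r = -(i : ℤ) ∧ p - r = 2 * n + 2 - (j : ℤ))) :
    Q.IsMinimalPair α β γ := by
  choose A P hA hP using fun δ : PosRoot n =>
    exists_lab_of_isPosRoot hn hξ.isHt Q.fold_head δ.2
  have i1 := hi.one_le
  have i2 := hi.le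
  have j1 := hj.one_le
  have j2 := hj.le
  have k1 := hk.one_le
  have k2 := hk.le
  refine isMinimalPair_of_forall hn hξ hsum ?_ ?_ fun m hm hint => ?_
  · rw [prec_iff hn hξ hi hk hα hγ]; omega
  · rw [prec_iff hn hξ hk hj hγ hβ]; omega
  have hsums := fun f (hf : Function.Antiperiodic f (2 * n + 2 : ℤ)) =>
    sum_eq_of_weight_eq hn hξ hk hγ hA hP hm hf
  have hne : ∀ δ ∈ m.support, m δ ≠ 0 := fun δ => Finsupp.mem_support_iff.1
  have hord : ∀ δ ∈ m.support, (1 ≤ A δ ∧ A δ ≤ n) ∧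
      (¬ (i = A δ ∧ p = P δ) ∧ (i : ℤ) - A δ ≤ p - P δ ∧ (A δ : ℤ) - i ≤ p - P δ) ∧
      (¬ (A δ = j ∧ P δ = q) ∧ (A δ : ℤ) - j ≤ P δ - q ∧ (j : ℤ) - A δ ≤ P δ - q) := by
    intro δ hδ
    have := hint δ (hne δ hδ)
    rw [prec_iff hn hξ hi (hA δ) hα (hP δ), prec_iff hn hξ (hA δ) hj (hP δ) hβ] at this
    exact ⟨⟨(hA δ).one_le, (hA δ).le⟩, this⟩
  have hex : ∃ δ ∈ m.support, P δ - A δ = r - k ∧ P δ + A δ = r + k := by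
    rcases h with ⟨e1, e2, e3⟩ | ⟨e1, e2, e3⟩ | ⟨e1, e2, e3⟩
    -- `μ` is the common endpoint `p - i = q + j`, and the interval of `γ` is the union of the two.
    · refine exists_interval_of_mid (μ := r + j - i) hne hsums (by omega) (by omega) (by omega)
        (fun δ hδ => ?_) (fun δ hδ => ?_) (fun δ hδ => ?_)
      all_goals
        have := hord δ hδ
        omega
    -- `γ` and `α` share their left end, while the right end `μ` of `β` is that of `α` moved down by
    -- one antiperiod.
    · refine exists_interval_of_left (μ := p + i - (2 * n + 2)) hne hsums (by omega)
        (by omega) (by omega) (fun δ hδ => ?_) (fun δ hδ => ?_)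
      all_goals
        have := hord δ hδ
        omega
    -- `γ` and `β` share their right end, while the left end `μ` of `α` is that of `β` moved up by
    -- one antiperiod.
    · refine exists_interval_of_right (μ := p - i) hne hsums (by omega)
        (by omega) (by omega) (fun δ hδ => ?_) (fun δ hδ => ?_)
      all_goals
        have := hord δ hδ
        omega
  obtain ⟨δ, hδ, e1, e2⟩ := hex
  have : δ = γ := Subtype.ext (by
    rw [hP δ, hγ]
    unfold rt
    rw [e1, e2])
  exact this ▸ hne δ hδ

theorem IsMinimalPair.lab_eq (hn : 1 ≤ n) (hξ : Q.IsHeight ξ)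
    (hi : Lab n ξ i p) (hj : Lab n ξ j q) (hk : Lab n ξ k r)
    (hα : α.val = rt (frame ξ Q.head) i p) (hβ : β.val = rt (frame ξ Q.head) j q)
    (hγ : γ.val = rt (frame ξ Q.head) k r) (hsum : α.val + β.val = γ.val)
    (hmin : Q.IsMinimalPair α β γ) :
    (i + j = k ∧ q - r = -(i : ℤ) ∧ p - r = (j : ℤ)) ∨
      (j + k = i ∧ q - r = (i : ℤ) - (2 * n + 2) ∧ p - r = (j : ℤ)) ∨
      (i + k = j ∧ q - r = -(i : ℤ) ∧ p - r = 2 * n + 2 - (j : ℤ)) := by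
  have hx := frame_antiperiodic (n := n) ξ Q.head
  have hh := hξ.isHt
  have i1 := hi.one_le
  have i2 := hi.le
  have i3 := hi.lower_le
  have i4 := hi.le_ht
  have j1 := hj.one_le
  have j2 := hj.le
  have j3 := hj.lower_le
  have j4 := hj.le_ht
  have hl1 := hh.le_add i1 i2 j1 j2
  have hprec := (prec_iff hn hξ hi hj hα hβ).1 hmin.1
  have hdot : α.val ⬝ᵥ β.val = -1 := by
    have h1 := γ.2.dotProduct_self
    rw [← hsum, add_dotProduct, dotProduct_add, dotProduct_add, α.2.dotProduct_self,
      β.2.dotProduct_self, dotProduct_comm β.val α.val] at h1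
    omega
  have hsum2 : frame ξ Q.head (p + i) - frame ξ Q.head (p - i) +
      (frame ξ Q.head (q + j) - frame ξ Q.head (q - j)) = γ.val := by
    rw [← hsum, hα, hβ]; rfl
  have hpar : 2 ∣ p + i - (q + j) := by
    have := (hi.dvd hh).1
    have := (hj.dvd hh).1
    omega
  rw [hα, hβ, rt_dotProduct hn hh Q.head hi hj] at hdot
  -- Inner product `-1` needs a shared endpoint, possibly modulo the antiperiod; `α ≺ β` and the
  -- bounds on labels leave these three.
  have hcases : p - i = q + j ∨ p + i = q + j + (2 * n + 2) ∨ p - i = q - j + (2 * n + 2) := by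
    unfold pair at hdot
    split_ifs at hdot <;> omega
  rcases hcases with e | e | e
  · rcases lt_trichotomy (i + j) (n + 1) with hlt | heq | hgt
    · left
      have hc : Lab n ξ (i + j) (p - j) := hi.of_between hh hj (by omega) (by omega)
        (by push_cast; omega) (by push_cast; omega) (by push_cast; omega) (by push_cast; omega)
        (by push_cast; omega)
      have hu := hc.unique (hd := Q.head) hn hh hk (by
        rw [← hγ, ← hsum2, e, rt, show p - j + ((i + j : ℕ) : ℤ) = p + i by push_cast; ring,
          show p - j - ((i + j : ℕ) : ℤ) = q - j by push_cast; omega]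
        abel)
      omega
    · exfalso
      -- The outer ends `p + i` and `q - j` differ by one antiperiod, so their vectors are opposite
      -- and their difference is not a root.
      have h2 : γ.val = (2 : ℤ) • frame ξ Q.head (p + i) := by
        rw [← hsum2, e, show p + i = q - j + (2 * n + 2) by omega, hx, two_smul]
        abel
      have h3 := γ.2.dotProduct_self
      rw [h2, smul_dotProduct, dotProduct_smul, smul_eq_mul, smul_eq_mul] at h3
      omega
    · exfalso
      have hc : Lab n ξ (2 * n + 2 - (i + j)) (p - j) := hi.of_between hh hj (by omega) (by omega)
        (by omega) (by omega) (by omega) (by omega) (by omega)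
      have hu := hc.unique (hd := Q.head) hn hh hk (by
        rw [← hγ, ← hsum2, e, rt,
          show p - j + ((2 * n + 2 - (i + j) : ℕ) : ℤ) = q - j + (2 * n + 2) by omega,
          show p - j - ((2 * n + 2 - (i + j) : ℕ) : ℤ) = p + i - (2 * n + 2) by omega, hx,
          hx.sub_eq]
        abel)
      -- The union of the intervals is longer than the antiperiod, and `γ` is `[p + i - L, q - j +
      -- L]` with `L = 2n+2`. It still contains the common endpoint `p - i`; cutting there gives
      -- `α'` and `β'`.
      have ha' : Lab n ξ (n + 1 - j) (p - i + (n + 1 - j)) := hi.of_between hh hj (by omega)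
        (by omega) (by omega) (by omega) (by omega) (by omega) (by omega)
      have hb' : Lab n ξ (n + 1 - i) (p - n - 1) := hi.of_between hh hj (by omega)
        (by omega) (by omega) (by omega) (by omega) (by omega) (by omega)
      let α' : PosRoot n := ⟨_, isPosRoot_rt hn hh Q.fold_head ha'⟩
      let β' : PosRoot n := ⟨_, isPosRoot_rt hn hh Q.fold_head hb'⟩
      refine hmin.false_of_between hn hξ (α' := α') (β' := β') hsum ?_ ?_ ?_ ?_ ?_
      · rw [hγ]
        change rt _ _ _ + rt _ _ _ = rt _ _ _
        unfold rt
        rw [show p - i + (n + 1 - j) + ((n + 1 - j : ℕ) : ℤ) = r + k by omega,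
          show p - i + (n + 1 - j) - ((n + 1 - j : ℕ) : ℤ) = p - i by omega,
          show p - n - 1 + ((n + 1 - i : ℕ) : ℤ) = p - i by omega,
          show p - n - 1 - ((n + 1 - i : ℕ) : ℤ) = r - k by omega]
        abel
      · rw [prec_iff hn hξ hi ha' hα rfl]; omega
      · rw [prec_iff hn hξ ha' hk rfl hγ]; omega
      · rw [prec_iff hn hξ hk hb' hγ rfl]; omega
      · rw [prec_iff hn hξ hb' hj rfl hβ]; omega
  · right; left
    have hij : j < i := by omega
    have hc : Lab n ξ (i - j) (p - j) := hi.of_between hh hj (by omega) (by omega)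
      (by omega) (by omega) (by omega) (by omega) (by omega)
    have hu := hc.unique (hd := Q.head) hn hh hk (by
      rw [← hγ, ← hsum2, e, hx, rt, show p - j + ((i - j : ℕ) : ℤ) = q - j + (2 * n + 2) by omega,
        show p - j - ((i - j : ℕ) : ℤ) = p - i by omega, hx]
      abel)
    omega
  · right; right
    have hij : i < j := by omega
    have hc : Lab n ξ (j - i) (q + i) := hi.of_between hh hj (by omega) (by omega)
      (by omega) (by omega) (by omega) (by omega) (by omega)
    have hu := hc.unique (hd := Q.head) hn hh hk (by
      rw [← hγ, ← hsum2, e, hx, rt, show q + i + ((j - i : ℕ) : ℤ) = q + j by omega,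
        show q + i - ((j - i : ℕ) : ℤ) = p + i - (2 * n + 2) by omega, hx.sub_eq]
      abel)
    omega

end TwistedQuiver

/-- As all indices are positive, an index equal to the sum of the other two is the strict maximum,
so the condition on the multiset singles out the right line of the formula. -/
theorem max_erase_iff {n i j k : ℕ} {p q r : ℤ} (hi : 1 ≤ i) (hj : 1 ≤ j) (hk : 1 ≤ k)
    (hin : i ≤ n) (hjn : j ≤ n) (hkn : k ≤ n) :
    (∃ l : ℕ, l = max i (max j k) ∧ l ≤ n ∧
        (({i, j, k} : Multiset ℕ).erase l).sum = l ∧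
        ((l = k ∧ q - r = -(i : ℤ) ∧ p - r = (j : ℤ)) ∨
          (l = i ∧ q - r = (i : ℤ) - (2 * n + 2) ∧ p - r = (j : ℤ)) ∨
          (l = j ∧ q - r = -(i : ℤ) ∧ p - r = 2 * n + 2 - (j : ℤ)))) ↔
    (i + j = k ∧ q - r = -(i : ℤ) ∧ p - r = (j : ℤ)) ∨
      (j + k = i ∧ q - r = (i : ℤ) - (2 * n + 2) ∧ p - r = (j : ℤ)) ∨
      (i + k = j ∧ q - r = -(i : ℤ) ∧ p - r = 2 * n + 2 - (j : ℤ)) := by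
  have herase : ∀ l, l = max i (max j k) →
      l + (({i, j, k} : Multiset ℕ).erase l).sum = i + (j + k) := by
    intro l hl
    rw [Multiset.sum_erase (by simp; omega)]
    simp
  constructor
  · rintro ⟨l, hl, -, hs, h⟩
    have := herase l hl
    omega
  · intro h
    have := herase _ rfl
    refine ⟨_, rfl, by omega, by omega, ?_⟩
    omega

end TwistedD

theorem corollary8p25 (n : ℕ) (hn : 2 ≤ n) (Q : TwistedD.TwistedQuiver n)
    (c : List (Fin (n + 1))) (hc : Q.IsCoxeterWord c) (ξ : ℕ → ℤ) (hξ : Q.IsHeight ξ)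
    (α β γ : TwistedD.PosRoot n) (i j k : ℕ) (p q r : ℤ)
    (hα : TwistedD.FoldedCoord c ξ α i p)
    (hβ : TwistedD.FoldedCoord c ξ β j q)
    (hγ : TwistedD.FoldedCoord c ξ γ k r)
    (hsum : α.val + β.val = γ.val) :
    Q.IsMinimalPair α β γ ↔
      ∃ l : ℕ, l = max i (max j k) ∧ l ≤ n ∧
        (({i, j, k} : Multiset ℕ).erase l).sum = l ∧
        ((l = k ∧ q - r = -(i : ℤ) ∧ p - r = (j : ℤ)) ∨
          (l = i ∧ q - r = (i : ℤ) - (2 * n + 2) ∧ p - r = (j : ℤ)) ∨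
          (l = j ∧ q - r = -(i : ℤ) ∧ p - r = 2 * n + 2 - (j : ℤ))) := by
  have hn1 : 1 ≤ n := by omega
  obtain ⟨hi, hα⟩ := hc.lab_of_foldedCoord hn1 hξ hα
  obtain ⟨hj, hβ⟩ := hc.lab_of_foldedCoord hn1 hξ hβ
  obtain ⟨hk, hγ⟩ := hc.lab_of_foldedCoord hn1 hξ hγ
  rw [TwistedD.max_erase_iff hi.one_le hj.one_le hk.one_le hi.le hj.le hk.le]
  exact ⟨fun h => h.lab_eq hn1 hξ hi hj hk hα hβ hγ hsum,
    TwistedD.TwistedQuiver.isMinimalPair_of_lab hn1 hξ hi hj hk hα hβ hγ hsum⟩
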